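/- Let $q\in C^\infty[0,\infty)$ be a real potential with $\operatorname{supp}q\subset[0,a]$, $0\le a<\infty$. For a control $f$, let $u^f$ denote the solution of the scattering problem $$u_{tt}-u_{xx}+qu=0\ \ (x>0,\ t<x),\qquad u|_{t<-x}=0,\qquad \lim_{s\to\infty}u(s,\tau-s)=f(\tau)\ \ (\tau\ge 0).$$ Then there is a function $w$, continuous on $\{x\ge0,\ -x\le t\le x\}$, such that $u^\delta(x,t)=\delta(x+t)+w(x,t)$ (with $w=0$ for $t<-x$) is the fundamental solution of the problem: for every smooth $f$ vanishing near $\tau=0$, the convolution in time $$u^f(x,t)=f(x+t)+\int_0^{x+t}w(x,t-s)f(s)\,ds$$ (equal to $0$ for $x+t\le 0$) is the classical solution. For $f\in L_2(0,\infty)$ the solution $u^f$ is defined by the same formula. For $x>a$ and $-x\le t\le x$ one has $w(x,t)=r(x-t)$, where $r(\tau)=\lim_{s\to\infty}w(s,s-\tau)$ is the response function. The control operator $(Wf)(x)=u^f(x,0)$ is a bounded bijective operator in $L_2(0,\infty)$. Put $C=W^*W$. Let $k>0$ and let $y$ satisfy $-y''+qy=-k^2y$ for $x>0$ and $y(x)=e^{-kx}$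 for $x>a$. Then $y\in L_2(0,\infty)$, and the control $f=W^{-1}y$ is the unique solution in $L_2(0,\infty)$ of the equation $Cf=e^{-k(\cdot)}$; moreover $f$ satisfies $$f(\tau)+\int_0^\infty r(\tau+s)f(s)\,ds=e^{-k\tau}\qquad\text{for almost every }\tau\ge 0 .$$ Furthermore, for $\xi>0$ let $y^\xi$ be equal to $0$ on $[0,\xi)$ and to $y$ on $[\xi,\infty)$. Then $f^\xi=W^{-1}y^\xi$ vanishes on $(0,\xi)$, it has a representative $f(\xi,\tau)=f^\xi(\tau)$ that is continuous on $\{0<\xi\le\tau\}$, one has $f^\xi(\xi)=y(\xi)$, and $$f^\xi(\tau)+\int_\xi^\infty r(\tau+s)f^\xi(s)\,ds=e^{-k\tau}\qquad(\tau\ge\xi).$$ This family is differentiable with respect to $\xi$ on $0<\xi\le\tau$ (from the left at $\xi=\tau$), and $$f_\xi(\xi,\tau)+\int_\xi^\infty r(\tau+s)f_\xi(\xi,s)\,ds=r(\tau+\xi)f^\xi(\xi)\qquad(\tau\ge\xi).$$ Hence, whenever $f^\xi(\xi)\ne0$, the function $g(\xi,\tau)=[f^\xi(\xi)]^{-1}f_\xi(\xi,\tau)$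 satisfies the Marchenko equation $$g(\xi,\tau)+\int_\xi^\infty r(\tau+s)g(\xi,s)\,ds=r(\tau+\xi)\qquad(\tau\ge\xi).$$ All the integrals converge absolutely. -/

import Mathlib

open Set Filter Topology MeasureTheory
open scoped ContDiff InnerProductSpace

namespace Scattering

/-- Lebesgue measure on the half-line `(0, ∞)`. -/
noncomputable abbrev halfLine : Measure ℝ := volume.restrict (Ioi (0 : ℝ))

/-- The real Hilbert space `L₂(0, ∞)`. It is the space of controls (functions of `τ`) and also
the space of states (functions of `x`). -/
abbrev L2Half : Type := Lp ℝ 2 halfLine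

/-- `u = u(x,t)` is a classical solution of the scattering problem with potential `q` and
control `f`:
`u_tt - u_xx + q u = 0` for `x > 0`, `t < x`;  `u = 0` for `t < -x`;
`u(s, τ - s) → f(τ)` as `s → ∞`, for every `τ ≥ 0`. -/
structure IsClassicalWave (q f : ℝ → ℝ) (u : ℝ → ℝ → ℝ) : Prop where
  contDiffOn : ContDiffOn ℝ 2 (fun p : ℝ × ℝ => u p.1 p.2) {p | 0 < p.1 ∧ p.2 < p.1}
  wave_eq : ∀ x t : ℝ, 0 < x → t < x →
    deriv (deriv fun t' => u x t') t - deriv (deriv fun x' => u x' t) x + q x * u x t = 0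
  eq_zero : ∀ x t : ℝ, 0 < x → t < -x → u x t = 0
  incident : ∀ τ : ℝ, 0 ≤ τ → Tendsto (fun s => u s (τ - s)) atTop (𝓝 (f τ))

/-- The Duhamel convolution in time of `δ(x + t) + w(x,t)` with `f`, where `w(x,·)` is understood
as `0` on `t < -x` and `f` as `0` on `τ ≤ 0`. -/
noncomputable def duhamel (w : ℝ → ℝ → ℝ) (f : ℝ → ℝ) (x t : ℝ) : ℝ :=
  (Ioi (0 : ℝ)).indicator f (x + t) + ∫ s in Ioc 0 (x + t), w x (t - s) * f s

/-- `u^δ(x,t) = δ(x + t) + w(x,t)` is the fundamental solution of the scattering problem: `w` is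
continuous up to the boundary of the wedge `-x ≤ t ≤ x`, and for every smooth control vanishing
near `τ = 0` the convolution `u^δ * f` is the classical solution. -/
structure IsFundamentalKernel (q : ℝ → ℝ) (w : ℝ → ℝ → ℝ) : Prop where
  continuousOn : ContinuousOn (fun p : ℝ × ℝ => w p.1 p.2)
    {p | 0 ≤ p.1 ∧ -p.1 ≤ p.2 ∧ p.2 ≤ p.1}
  isClassicalWave : ∀ f : ℝ → ℝ, ContDiff ℝ ∞ f → (∃ ε > 0, ∀ τ < ε, f τ = 0) →
    IsClassicalWave q f (duhamel w f)

/-- The regular part `w` of the fundamental solution `δ(x + t) + w(x,t)` for the potential `q`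
(its values on `-x ≤ t ≤ x` are determined by `IsFundamentalKernel`). -/
noncomputable def kernel (q : ℝ → ℝ) : ℝ → ℝ → ℝ :=
  Classical.epsilon (IsFundamentalKernel q)

/-- The generalized solution `u^f = u^δ * f` for a control `f ∈ L₂(0, ∞)`. -/
noncomputable def wave (q : ℝ → ℝ) (f : L2Half) : ℝ → ℝ → ℝ :=
  duhamel (kernel q) f

/-- The response function `r(τ) = lim_{s → ∞} w(s, s - τ)`, that is, the outgoing profile in
`u^δ(x,t) = δ(x + t) + r(x - t)` for large `x`. -/
noncomputable def response (q : ℝ → ℝ) (τ : ℝ) : ℝ :=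
  limUnder atTop fun s : ℝ => kernel q s (s - τ)

/-- `W` is the bounded operator `(W f)(x) = u^f(x, 0)` of `L₂(0, ∞)`. -/
def IsControlOperator (q : ℝ → ℝ) (W : L2Half →L[ℝ] L2Half) : Prop :=
  ∀ f : L2Half, W f =ᵐ[halfLine] fun x => wave q f x 0

/-- The control operator `W` (an operator with `IsControlOperator` is unique). -/
noncomputable def controlOperator (q : ℝ → ℝ) : L2Half →L[ℝ] L2Half :=
  Classical.epsilon (IsControlOperator q)

/-- The connecting operator `C = W* W`. -/
noncomputable def connectingOperator (q : ℝ → ℝ) : L2Half →L[ℝ] L2Half :=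
  (ContinuousLinearMap.adjoint (controlOperator q)) ∘L (controlOperator q)

/-- `-y'' + q y = -k² y` for `x > 0`, and `y = e^{-kx}` for `x > a` (where `a ≥ 0`). -/
structure IsSpecialTarget (q : ℝ → ℝ) (a k : ℝ) (y : ℝ → ℝ) : Prop where
  differentiableOn : DifferentiableOn ℝ y (Ioi 0)
  differentiableOn_deriv : DifferentiableOn ℝ (deriv y) (Ioi 0)
  ode : ∀ x : ℝ, 0 < x → -deriv (deriv y) x + q x * y x = -k ^ 2 * y x
  eq_exp : ∀ x : ℝ, a < x → y x = Real.exp (-k * x)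

/-- `g(τ) + ∫_ξ^∞ r(τ + s) g(s) ds = h(τ)` at the point `τ`, with a convergent integral. -/
def EqAt (r : ℝ → ℝ) (ξ : ℝ) (g h : ℝ → ℝ) (τ : ℝ) : Prop :=
  IntegrableOn (fun s => r (τ + s) * g s) (Ioi ξ) ∧
    g τ + ∫ s in Ioi ξ, r (τ + s) * g s = h τ

end Scattering

open Scattering

namespace Scattering

/-! ### Calculus of functions of two real variables -/

/-! In the characteristic coordinates ξ = x + t, η = x - t the wave equation reads u_ξη = (q/4) u.
The regular part of the fundamental solution is G(x + t, x - t), where G solves a Goursat problem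
for this equation with G_η(0, η) = q(η/2)/4 and G = 0 for ξ ≥ 0, η ≥ 2a (`exists_goursatKernel`).
`IsClassicalWave.unique` and `IsFundamentalKernel.eq_on_wedge` identify it on the wedge with the
kernel chosen by `Classical.epsilon`. Hence W = 1 + V, where V is a Volterra operator with kernel
K(x, s) = G(x - s, x + s), zero for x ≥ 2a, and W is inverted by 1 plus the Volterra operator with
the resolvent kernel L.

The heart is `intertwining`: the transpose of W, applied in x at each fixed time, turns a solution Φ
of the wave equation into a solution Ψ of Ψ_ξη = 0. Such a Ψ obeys the parallelogram identity, and Ψ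
= Φ for x ≥ a, so the transform can be read off from the values of Φ far away. Two choices of Φ
carry the theorem. With Φ = G one gets that W*W is the identity plus the Hankel operator with kernel
r(τ + s) = G(2a, τ + s) (`hankel`, `hankel_apply`). With Φ = e^{kt} y(x), which is e^{-kη} for x >
a, one gets that W*y is e^{-kτ} (`transform_target`). So Cf = e^{-kτ}, and the solution is unique
because W is injective.

The operators W and W* are triangular in opposite directions: the value at τ of W⁻¹y^ξ uses y on [ξ,
τ] only, and the value at τ ≥ ξ of W*y^ξ uses y on [τ, ∞) only. Both identities therefore restrict
to [ξ, ∞), and f^ξ(τ) = y(τ) + ∫_ξ^τ L(τ, s) y(s) ds. Its ξ-derivative is -L(τ, ξ) y(ξ), so the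
Marchenko solution is -L(·, ξ). Its equation does not require differentiating the integral equation
for f^ξ: by the resolvent identity 1 + V sends L(·, ξ) on [ξ, ∞) to -K(·, ξ), and `hankel` evaluates
the transpose on K(·, ξ) as r(τ + ξ). -/

theorem contDiff_succ_of_partial {n : ℕ} {u u₁ u₂ : ℝ → ℝ → ℝ}
    (h₁ : ∀ x y, HasDerivAt (fun x' => u x' y) (u₁ x y) x)
    (h₂ : ∀ x y, HasDerivAt (fun y' => u x y') (u₂ x y) y)
    (c₁ : ContDiff ℝ n (fun p : ℝ × ℝ => u₁ p.1 p.2))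
    (c₂ : ContDiff ℝ n (fun p : ℝ × ℝ => u₂ p.1 p.2)) :
    ContDiff ℝ (n + 1 : ℕ) (fun p : ℝ × ℝ => u p.1 p.2) := by
  have hF : ∀ p : ℝ × ℝ, HasFDerivAt (fun p : ℝ × ℝ => u p.1 p.2)
      (u₁ p.1 p.2 • ContinuousLinearMap.fst ℝ ℝ ℝ + u₂ p.1 p.2 • ContinuousLinearMap.snd ℝ ℝ ℝ) p := by
    intro p
    have := hasStrictFDerivAt_uncurry_coprod (𝕜 := ℝ) (u := p) (f := u)
      (f₁ := fun x y => ContinuousLinearMap.toSpanSingleton ℝ (u₁ x y))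
      (f₂ := fun x y => ContinuousLinearMap.toSpanSingleton ℝ (u₂ x y))
      (Eventually.of_forall fun v => (h₁ v.1 v.2).hasFDerivAt)
      (Eventually.of_forall fun v => (h₂ v.1 v.2).hasFDerivAt)
      (by
        have : Continuous fun p : ℝ × ℝ => ContinuousLinearMap.toSpanSingleton ℝ (u₁ p.1 p.2) :=
          (ContinuousLinearMap.toSpanSingletonCLE (𝕜 := ℝ) (E := ℝ)).continuous.comp c₁.continuous
        exact this.continuousAt)
      (by
        have : Continuous fun p : ℝ × ℝ => ContinuousLinearMap.toSpanSingleton ℝ (u₂ p.1 p.2) :=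
          (ContinuousLinearMap.toSpanSingletonCLE (𝕜 := ℝ) (E := ℝ)).continuous.comp c₂.continuous
        exact this.continuousAt)
    refine this.hasFDerivAt.congr_fderiv ?_
    ext <;> simp [Function.HasUncurry.uncurry]
  push_cast
  rw [contDiff_succ_iff_hasFDerivAt]
  refine ⟨_, ?_, hF⟩
  fun_prop

theorem hasDerivAt_parametric {h h₁ : ℝ → ℝ → ℝ}
    (hc : Continuous fun p : ℝ × ℝ => h p.1 p.2) (hc₁ : Continuous fun p : ℝ × ℝ => h₁ p.1 p.2)
    (hd : ∀ x s, HasDerivAt (fun x' => h x' s) (h₁ x s) x) (a b x : ℝ) :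
    HasDerivAt (fun x => ∫ s in a..b, h x s) (∫ s in a..b, h₁ x s) x := by
  obtain ⟨C, hC⟩ := ((isCompact_Icc (a := x - 1) (b := x + 1)).prod
    (isCompact_uIcc (a := a) (b := b))).exists_bound_of_continuousOn hc₁.continuousOn
  refine (intervalIntegral.hasDerivAt_integral_of_dominated_loc_of_deriv_le
    (F := h) (F' := h₁) (bound := fun _ => C)
    (s := Icc (x - 1) (x + 1)) (Icc_mem_nhds (by linarith) (by linarith)) ?_ ?_ ?_ ?_ ?_ ?_).2
  · refine Eventually.of_forall fun y => ?_
    have : Continuous (h y) := by fun_prop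
    exact this.aestronglyMeasurable
  · have : Continuous (h x) := by fun_prop
    exact this.intervalIntegrable _ _
  · have : Continuous (h₁ x) := by fun_prop
    exact this.aestronglyMeasurable
  · exact ae_of_all _ fun t ht y hy => hC (y, t) ⟨hy, uIoc_subset_uIcc ht⟩
  · exact intervalIntegrable_const
  · exact ae_of_all _ fun t _ y _ => hd y t

theorem continuous_primitive_snd {h : ℝ → ℝ → ℝ} (hc : Continuous fun p : ℝ × ℝ => h p.1 p.2)
    (c : ℝ) : Continuous fun p : ℝ × ℝ => ∫ s in c..p.2, h p.1 s := by
  exact intervalIntegral.continuous_parametric_intervalIntegral_of_continuous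
    (f := fun (p : ℝ × ℝ) s => h p.1 s) (by fun_prop) continuous_snd

theorem hasDerivAt_primitive {g : ℝ → ℝ} (hg : Continuous g) (c x : ℝ) :
    HasDerivAt (fun x => ∫ s in c..x, g s) (g x) x :=
  intervalIntegral.integral_hasDerivAt_right (hg.intervalIntegrable _ _)
    (hg.stronglyMeasurableAtFilter _ _) hg.continuousAt

/-- The partial derivative in the first variable. -/
noncomputable def D₁ (u : ℝ → ℝ → ℝ) (x y : ℝ) : ℝ := deriv (fun x' => u x' y) x

/-- The partial derivative in the second variable. -/
noncomputable def D₂ (u : ℝ → ℝ → ℝ) (x y : ℝ) : ℝ := deriv (fun y' => u x y') y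

section Partial
variable {u : ℝ → ℝ → ℝ}

theorem hasDerivAt_line (hu : ContDiff ℝ 1 fun p : ℝ × ℝ => u p.1 p.2) (x y a b : ℝ) {f g : ℝ → ℝ}
    {t : ℝ} (hf : HasDerivAt f a t) (hg : HasDerivAt g b t) (hx : f t = x) (hy : g t = y) :
    HasDerivAt (fun s => u (f s) (g s)) (a * fderiv ℝ (fun p : ℝ × ℝ => u p.1 p.2) (x, y) (1, 0)
      + b * fderiv ℝ (fun p : ℝ × ℝ => u p.1 p.2) (x, y) (0, 1)) t := by
  subst hx hy
  have h := (hu.differentiable one_ne_zero (f t, g t)).hasFDerivAt.comp_hasDerivAt t (hf.prodMk hg)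
  refine h.congr_deriv ?_
  rw [← smul_eq_mul, ← smul_eq_mul, ← map_smul, ← map_smul, ← map_add]
  simp

theorem D₁_eq_fderiv (hu : ContDiff ℝ 1 fun p : ℝ × ℝ => u p.1 p.2) (x y : ℝ) :
    D₁ u x y = fderiv ℝ (fun p : ℝ × ℝ => u p.1 p.2) (x, y) (1, 0) := by
  have := hasDerivAt_line hu x y 1 0 (hasDerivAt_id x) (hasDerivAt_const x y) rfl rfl
  simpa [D₁] using this.deriv

theorem D₂_eq_fderiv (hu : ContDiff ℝ 1 fun p : ℝ × ℝ => u p.1 p.2) (x y : ℝ) :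
    D₂ u x y = fderiv ℝ (fun p : ℝ × ℝ => u p.1 p.2) (x, y) (0, 1) := by
  have := hasDerivAt_line hu x y 0 1 (hasDerivAt_const y x) (hasDerivAt_id y) rfl rfl
  simpa [D₂] using this.deriv

theorem hasDerivAt_comp₂ (hu : ContDiff ℝ 1 fun p : ℝ × ℝ => u p.1 p.2) {a b t : ℝ} {f g : ℝ → ℝ}
    (hf : HasDerivAt f a t) (hg : HasDerivAt g b t) :
    HasDerivAt (fun s => u (f s) (g s)) (a * D₁ u (f t) (g t) + b * D₂ u (f t) (g t)) t := by
  rw [D₁_eq_fderiv hu, D₂_eq_fderiv hu]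
  exact hasDerivAt_line hu _ _ a b hf hg rfl rfl

theorem contDiff_D₁ {n : ℕ} (hu : ContDiff ℝ (n + 1 : ℕ) fun p : ℝ × ℝ => u p.1 p.2) :
    ContDiff ℝ n fun p : ℝ × ℝ => D₁ u p.1 p.2 := by
  have h1 : ContDiff ℝ 1 fun p : ℝ × ℝ => u p.1 p.2 := hu.of_le (by norm_cast; omega)
  simp_rw [D₁_eq_fderiv h1]
  exact (hu.fderiv_right (m := n) (by norm_cast)).clm_apply contDiff_const

theorem contDiff_D₂ {n : ℕ} (hu : ContDiff ℝ (n + 1 : ℕ) fun p : ℝ × ℝ => u p.1 p.2) :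
    ContDiff ℝ n fun p : ℝ × ℝ => D₂ u p.1 p.2 := by
  have h1 : ContDiff ℝ 1 fun p : ℝ × ℝ => u p.1 p.2 := hu.of_le (by norm_cast; omega)
  simp_rw [D₂_eq_fderiv h1]
  exact (hu.fderiv_right (m := n) (by norm_cast)).clm_apply contDiff_const

theorem hasDerivAt_D₁ (hu : ContDiff ℝ 1 fun p : ℝ × ℝ => u p.1 p.2) (x y : ℝ) :
    HasDerivAt (fun x' => u x' y) (D₁ u x y) x := by
  simpa using hasDerivAt_comp₂ hu (hasDerivAt_id x) (hasDerivAt_const x y)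

theorem hasDerivAt_D₂ (hu : ContDiff ℝ 1 fun p : ℝ × ℝ => u p.1 p.2) (x y : ℝ) :
    HasDerivAt (fun y' => u x y') (D₂ u x y) y := by
  simpa using hasDerivAt_comp₂ hu (hasDerivAt_const y x) (hasDerivAt_id y)

end Partial

theorem contDiff_one_primitive_snd {h : ℝ → ℝ → ℝ}
    (hh : ContDiff ℝ 1 fun p : ℝ × ℝ => h p.1 p.2) (c : ℝ) :
    ContDiff ℝ 1 fun p : ℝ × ℝ => ∫ s in c..p.2, h p.1 s := by
  have hD : Continuous fun p : ℝ × ℝ => D₁ h p.1 p.2 := (contDiff_D₁ (n := 0) (by simpa using hh)).continuous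
  have hc := hh.continuous
  have := contDiff_succ_of_partial (n := 0) (u := fun x y => ∫ s in c..y, h x s)
    (fun x y => hasDerivAt_parametric hc hD (fun x s => hasDerivAt_D₁ hh x s) c y x)
    (fun x y => hasDerivAt_primitive (by fun_prop : Continuous (h x)) c y)
    (contDiff_zero.2 (continuous_primitive_snd hD c)) (contDiff_zero.2 hc)
  simpa using this

/-- As a function of parameter and endpoint separately, the integral is C¹, since both partial
derivatives are continuous; the chain rule on the diagonal gives the two terms. -/
theorem hasDerivAt_leibniz {h h₁ : ℝ → ℝ → ℝ}
    (hc : Continuous fun p : ℝ × ℝ => h p.1 p.2) (hc₁ : Continuous fun p : ℝ × ℝ => h₁ p.1 p.2)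
    (hd : ∀ x s, HasDerivAt (fun x' => h x' s) (h₁ x s) x) (c x : ℝ) :
    HasDerivAt (fun x => ∫ s in c..x, h x s) (h x x + ∫ s in c..x, h₁ x s) x := by
  have hp₁ := fun x y => hasDerivAt_parametric hc hc₁ hd c y x
  have hp₂ := fun x y => hasDerivAt_primitive (by fun_prop : Continuous (h x)) c y
  have := contDiff_succ_of_partial (n := 0) (u := fun x y => ∫ s in c..y, h x s) hp₁ hp₂
    (contDiff_zero.2 (continuous_primitive_snd hc₁ c)) (contDiff_zero.2 hc)
  have h2 := hasDerivAt_comp₂ (u := fun x y => ∫ s in c..y, h x s) (by simpa using this)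
    (hasDerivAt_id x) (hasDerivAt_id x)
  refine h2.congr_deriv ?_
  simp only [D₁, D₂, id]
  rw [(hp₁ x x).deriv, (hp₂ x x).deriv]
  ring

/-- Change of the order of integration over a triangle. -/
theorem integral_triangle_swap {k : ℝ → ℝ → ℝ} (hk : Continuous fun p : ℝ × ℝ => k p.1 p.2)
    {f g : ℝ → ℝ} {a b : ℝ} (hab : a ≤ b) (hf : IntervalIntegrable f volume a b)
    (hg : IntervalIntegrable g volume a b) :
    ∫ x in a..b, f x * ∫ s in a..x, k x s * g s = ∫ s in a..b, (∫ x in s..b, f x * k x s) * g s := by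
  have key : IntegrableOn (fun p : ℝ × ℝ => ({p : ℝ × ℝ | p.2 ≤ p.1}.indicator
      (fun p => f p.1 * k p.1 p.2 * g p.2)) p) (uIoc a b ×ˢ uIoc a b) := by
    have hT : MeasurableSet {p : ℝ × ℝ | p.2 ≤ p.1} := measurableSet_le measurable_snd measurable_fst
    refine IntegrableOn.indicator ?_ hT
    obtain ⟨C, hC⟩ := ((isCompact_uIcc (a := a) (b := b)).prod
      (isCompact_uIcc (a := a) (b := b))).exists_bound_of_continuousOn hk.continuousOn
    -- The functions f and g are merely integrable, so Fubini rests on the product f(x) g(s) times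
    -- the bounded factor k.
    have h1 : IntegrableOn (fun p : ℝ × ℝ => f p.1 * g p.2) (uIoc a b ×ˢ uIoc a b) := by
      have := (hf.def'.mul_prod hg.def')
      rwa [Measure.prod_restrict, ← Measure.volume_eq_prod] at this
    have h2 := Integrable.bdd_mul (c := C) h1 hk.aestronglyMeasurable
      ((ae_restrict_iff' (measurableSet_uIoc.prod measurableSet_uIoc)).2
        (ae_of_all _ fun p hp => hC p ⟨uIoc_subset_uIcc hp.1, uIoc_subset_uIcc hp.2⟩))
    refine h2.congr (ae_of_all _ fun p => ?_)
    simp only; ring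
  have hs := intervalIntegral_intervalIntegral_swap (F := fun x s => ({p : ℝ × ℝ | p.2 ≤ p.1}.indicator
      (fun p => f p.1 * k p.1 p.2 * g p.2)) (x, s)) key
  have e1 : ∀ x ∈ uIcc a b, (∫ s in a..b, ({p : ℝ × ℝ | p.2 ≤ p.1}.indicator
      (fun p => f p.1 * k p.1 p.2 * g p.2)) (x, s)) = f x * ∫ s in a..x, k x s * g s := by
    intro x hx
    rw [uIcc_of_le hab] at hx
    rw [intervalIntegral.integral_of_le hab, intervalIntegral.integral_of_le hx.1,
      ← integral_const_mul, ← integral_indicator measurableSet_Ioc,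
      ← integral_indicator measurableSet_Ioc]
    congr 1
    ext s
    simp only [indicator, mem_Ioc, mem_ofPred_eq]
    split_ifs <;> first | ring1 | (exfalso; grind)
  have e2 : ∀ s ∈ Ioc a b, (∫ x in a..b, ({p : ℝ × ℝ | p.2 ≤ p.1}.indicator
      (fun p => f p.1 * k p.1 p.2 * g p.2)) (x, s)) = (∫ x in s..b, f x * k x s) * g s := by
    intro s hs
    rw [intervalIntegral.integral_of_le hab, intervalIntegral.integral_of_le hs.2,
      ← integral_mul_const, ← integral_Icc_eq_integral_Ioc (x := s),
      ← integral_indicator measurableSet_Ioc, ← integral_indicator measurableSet_Icc]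
    congr 1
    ext x
    simp only [indicator, mem_Ioc, mem_Icc, mem_ofPred_eq]
    split_ifs <;> first | ring1 | (exfalso; grind)
  rw [intervalIntegral.integral_congr (fun x hx => (e1 x hx).symm), hs]
  rw [intervalIntegral.integral_of_le hab, intervalIntegral.integral_of_le hab]
  exact setIntegral_congr_fun measurableSet_Ioc e2

/-! ### Volterra equations -/

theorem integral_abs_pow (n : ℕ) (x : ℝ) :
    |∫ s in (0 : ℝ)..x, |s| ^ n| = |x| ^ (n + 1) / (n + 1) := by
  rcases le_total 0 x with hx | hx
  · have : ∫ s in (0 : ℝ)..x, |s| ^ n = ∫ s in (0 : ℝ)..x, s ^ n := by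
      refine intervalIntegral.integral_congr fun s hs => ?_
      rw [uIcc_of_le hx] at hs
      simp only [abs_of_nonneg hs.1]
    rw [this, integral_pow, abs_of_nonneg hx]
    simp only [ne_eq, Nat.add_eq_zero_iff, one_ne_zero, and_false, not_false_eq_true, zero_pow, sub_zero]
    rw [abs_of_nonneg (by positivity)]
  · have : ∫ s in (0 : ℝ)..x, |s| ^ n = ∫ s in (0 : ℝ)..x, (-s) ^ n := by
      refine intervalIntegral.integral_congr fun s hs => ?_
      rw [uIcc_of_ge hx] at hs
      simp only [abs_of_nonpos hs.2]
    rw [this, intervalIntegral.integral_comp_neg (fun s => s ^ n), integral_pow, abs_of_nonpos hx]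
    simp only [neg_zero, ne_eq, Nat.add_eq_zero_iff, one_ne_zero, and_false, not_false_eq_true, zero_pow,
      zero_sub]
    rw [abs_div, abs_neg, abs_of_nonneg (pow_nonneg (by linarith : 0 ≤ -x) _),
      abs_of_nonneg (by positivity : (0 : ℝ) ≤ (n : ℝ) + 1)]

/-- Each integration contributes a factor 1/(n + 1); their product 1/n! drives the Volterra
iterations below. Nonnegativity of c follows from the bound at the endpoint when x ≠ 0. -/
theorem abs_integral_le_pow {h : ℝ → ℝ} {x c : ℝ} {n : ℕ}
    (hh : ∀ s ∈ uIcc 0 x, |h s| ≤ c * |s| ^ n) :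
    |∫ s in (0 : ℝ)..x, h s| ≤ c * |x| ^ (n + 1) / (n + 1) := by
  have h1 : ‖∫ s in (0 : ℝ)..x, h s‖ ≤ |∫ s in (0 : ℝ)..x, c * |s| ^ n| := by
    refine intervalIntegral.norm_integral_le_abs_of_norm_le ?_ ?_
    · exact (ae_restrict_iff' measurableSet_uIoc).2
        (ae_of_all _ fun s hs => hh s (uIoc_subset_uIcc hs))
    · exact (by fun_prop : Continuous fun s : ℝ => c * |s| ^ n).intervalIntegrable _ _
  have hc : 0 ≤ c * |x| ^ n := (abs_nonneg _).trans (hh x right_mem_uIcc)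
  rw [Real.norm_eq_abs, intervalIntegral.integral_const_mul, abs_mul, integral_abs_pow] at h1
  rcases eq_or_ne x 0 with rfl | hx
  · simp
  · have : 0 ≤ c := nonneg_of_mul_nonneg_left hc (by positivity)
    rwa [abs_of_nonneg this, ← mul_div_assoc] at h1

/-- Iterating the Volterra gain `c |τ|^n ↦ c M |τ|^(n+1) / (n+1)` forces a function to vanish. -/
theorem eq_zero_of_volterra_gain {X : Type*} {S : Set X} {ℓ : X → ℝ} {u : X → ℝ} {C M : ℝ}
    (h0 : ∀ x ∈ S, |u x| ≤ C)
    (hg : ∀ (n : ℕ) (c : ℝ), (∀ x ∈ S, |u x| ≤ c * |ℓ x| ^ n) →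
      ∀ x ∈ S, |u x| ≤ c * M * |ℓ x| ^ (n + 1) / (n + 1)) {x : X} (hx : x ∈ S) : u x = 0 := by
  have hn : ∀ n : ℕ, ∀ x ∈ S, |u x| ≤ C * M ^ n / n.factorial * |ℓ x| ^ n := by
    intro n
    induction n with
    | zero => simpa using h0
    | succ n ih =>
      intro x hx
      refine (hg n _ ih x hx).trans_eq ?_
      rw [Nat.factorial_succ]
      push_cast
      field_simp
      ring
  have hlim : Tendsto (fun n : ℕ => C * ((M * |ℓ x|) ^ n / n.factorial)) atTop (𝓝 (C * 0)) :=
    (FloorSemiring.tendsto_pow_div_factorial_atTop _).const_mul _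
  have : |u x| ≤ C * 0 := by
    refine ge_of_tendsto' hlim fun n => (hn n x hx).trans_eq ?_
    rw [mul_pow]; ring
  exact abs_eq_zero.1 (le_antisymm (by simpa using this) (abs_nonneg _))

/-- Solvability of a Volterra equation `u = g + T u` for continuous functions on the plane. -/
theorem exists_volterra_solution {T : (ℝ × ℝ → ℝ) → (ℝ × ℝ → ℝ)} {R₀ : ℝ}
    (hcont : ∀ u, Continuous u → Continuous (T u))
    (hadd : ∀ u v, Continuous u → Continuous v → T (u + v) = T u + T v)
    (hb : ∀ R ≥ R₀, ∃ M : ℝ, 0 ≤ M ∧ ∀ u, Continuous u → ∀ (n : ℕ) (c : ℝ),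
      (∀ x ∈ Metric.closedBall (0 : ℝ × ℝ) R, |u x| ≤ c * |x.1| ^ n) →
      ∀ x ∈ Metric.closedBall (0 : ℝ × ℝ) R, |T u x| ≤ c * M * |x.1| ^ (n + 1) / (n + 1))
    {g : ℝ × ℝ → ℝ} (hg : Continuous g) : ∃ u, Continuous u ∧ ∀ x, u x = g x + T u x := by
  -- The solution is the Neumann series of the Tⁿg, whose terms are at most |C| (M R)ⁿ/n! on each
  -- large ball of radius R.
  set a : ℕ → ℝ × ℝ → ℝ := fun n => T^[n] g with ha
  have hac : ∀ n, Continuous (a n) := by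
    intro n
    induction n with
    | zero => simpa [ha] using hg
    | succ n ih => simp only [ha, Function.iterate_succ_apply'] at ih ⊢; exact hcont _ ih
  have has : ∀ n, T (a n) = a (n + 1) := fun n => by simp only [ha, Function.iterate_succ_apply']
  have hT0 : T 0 = 0 := by
    have := hadd 0 0 continuous_zero continuous_zero
    simpa using this
  have hTS : ∀ N, T (∑ n ∈ Finset.range N, a n) = ∑ n ∈ Finset.range N, a (n + 1) ∧
      Continuous (∑ n ∈ Finset.range N, a n) := by
    intro N
    induction N with
    | zero => exact ⟨by simpa using hT0, by simpa using continuous_zero⟩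
    | succ N ih =>
      rw [Finset.sum_range_succ, Finset.sum_range_succ, hadd _ _ ih.2 (hac N), ih.1, has]
      exact ⟨rfl, ih.2.add (hac N)⟩
  have hbound : ∀ R ≥ R₀, ∃ v : ℕ → ℝ, Summable v ∧
      ∀ n, ∀ x ∈ Metric.closedBall (0 : ℝ × ℝ) R, ‖a n x‖ ≤ v n := by
    intro R hR
    obtain ⟨M, hM, hT⟩ := hb R hR
    obtain ⟨C, hC⟩ := (isCompact_closedBall (0 : ℝ × ℝ) R).exists_bound_of_continuousOn hg.continuousOn
    have hn : ∀ n : ℕ, ∀ x ∈ Metric.closedBall (0 : ℝ × ℝ) R,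
        |a n x| ≤ |C| * M ^ n / n.factorial * |x.1| ^ n := by
      intro n
      induction n with
      | zero => intro x hx; simpa [ha] using (hC x hx).trans (le_abs_self C)
      | succ n ih =>
        intro x hx
        rw [← has]
        refine (hT _ (hac n) n _ ih x hx).trans_eq ?_
        rw [Nat.factorial_succ]
        push_cast
        field_simp
        ring
    refine ⟨fun n => |C| * ((M * R) ^ n / n.factorial), (Real.summable_pow_div_factorial _).mul_left _,
      fun n x hx => (hn n x hx).trans ?_⟩
    have hx1 : |x.1| ≤ R := by
      have h := mem_closedBall_zero_iff.1 hx
      exact (norm_fst_le x).trans h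
    calc |C| * M ^ n / n.factorial * |x.1| ^ n ≤ |C| * M ^ n / n.factorial * R ^ n := by gcongr
      _ = |C| * ((M * R) ^ n / n.factorial) := by rw [mul_pow]; ring
  set u : ℝ × ℝ → ℝ := fun x => ∑' n, a n x with hu
  have hmax : ∀ x : ℝ × ℝ, ∃ R ≥ R₀, x ∈ Metric.ball (0 : ℝ × ℝ) R ∧ 0 ≤ R := fun x =>
    ⟨max R₀ (‖x‖ + 1), le_max_left _ _, by
      rw [mem_ball_zero_iff]; exact lt_of_lt_of_le (by linarith) (le_max_right _ _),
      le_trans (by positivity) (le_max_right _ _)⟩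
  have huc : Continuous u := by
    rw [continuous_iff_continuousAt]
    intro x
    obtain ⟨R, hR, hx, -⟩ := hmax x
    obtain ⟨v, hv, hav⟩ := hbound R hR
    exact (continuousOn_tsum (fun n => (hac n).continuousOn) hv hav).continuousAt
      (Filter.mem_of_superset (Metric.isOpen_ball.mem_nhds hx) Metric.ball_subset_closedBall)
  refine ⟨u, huc, fun x => ?_⟩
  obtain ⟨R, hR, hx, hR0⟩ := hmax x
  obtain ⟨v, hv, hav⟩ := hbound R hR
  obtain ⟨M, hM, hT⟩ := hb R hR
  have hxb := Metric.ball_subset_closedBall hx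
  have hunif := tendstoUniformlyOn_tsum_nat hv hav
  have hsum : HasSum (fun n => a n x) (u x) :=
    (Summable.of_norm_bounded hv fun n => hav n x hxb).hasSum
  have l1 : Tendsto (fun N => ∑ n ∈ Finset.range N, a (n + 1) x) atTop (𝓝 (u x - g x)) := by
    have := ((tendsto_add_atTop_iff_nat 1).2 hsum.tendsto_sum_nat).sub_const (g x)
    refine this.congr fun N => ?_
    rw [Finset.sum_range_succ']
    simp [ha]
  -- T passes through the sum: the remainder is uniformly small on the ball, and the gain estimate
  -- with n = 0 keeps its image under T small.
  have l2 : Tendsto (fun N => ∑ n ∈ Finset.range N, a (n + 1) x) atTop (𝓝 (T u x)) := by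
    rw [Metric.tendstoUniformlyOn_iff] at hunif
    rw [Metric.tendsto_atTop]
    intro ε hε
    obtain ⟨N₀, hN₀⟩ := eventually_atTop.1 (hunif (ε / (M * R + 1)) (by positivity))
    refine ⟨N₀, fun N hN => ?_⟩
    have hd : Continuous (u - ∑ n ∈ Finset.range N, a n) := huc.sub (hTS N).2
    have e : T u = T (u - ∑ n ∈ Finset.range N, a n) + ∑ n ∈ Finset.range N, a (n + 1) := by
      rw [← (hTS N).1, ← hadd _ _ hd (hTS N).2, sub_add_cancel]
    have hle := hT _ hd 0 (ε / (M * R + 1)) (fun z hz => by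
      have := (hN₀ N hN z hz).le
      simpa [Real.dist_eq] using this) x hxb
    have hx1 : |x.1| ≤ R := (norm_fst_le x).trans (mem_closedBall_zero_iff.1 hxb)
    rw [e, dist_comm, Real.dist_eq]
    simp only [Pi.add_apply, Finset.sum_apply, add_sub_cancel_right]
    refine lt_of_le_of_lt hle ?_
    simp only [zero_add, pow_one, Nat.cast_zero, div_one]
    calc ε / (M * R + 1) * M * |x.1| ≤ ε / (M * R + 1) * M * R := by gcongr
      _ = ε * (M * R / (M * R + 1)) := by ring
      _ < ε * 1 := by
        gcongr
        rw [div_lt_one (by positivity)]; linarith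
      _ = ε := mul_one _
  linarith [tendsto_nhds_unique l1 l2]

/-- The solution of the Goursat problem `u_ξη = p u`. -/
theorem exists_goursat_solution {p : ℝ → ℝ → ℝ} (hp : Continuous fun z : ℝ × ℝ => p z.1 z.2) (b : ℝ)
    {g : ℝ → ℝ → ℝ} (hg : Continuous fun z : ℝ × ℝ => g z.1 z.2) :
    ∃ u : ℝ → ℝ → ℝ, Continuous (fun z : ℝ × ℝ => u z.1 z.2) ∧
      ∀ ξ η, u ξ η = g ξ η + ∫ ξ' in (0 : ℝ)..ξ, ∫ η' in b..η, p ξ' η' * u ξ' η' := by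
  have hin : ∀ u : ℝ × ℝ → ℝ, Continuous u →
      Continuous fun z : ℝ × ℝ => ∫ η' in b..z.2, p z.1 η' * u (z.1, η') := fun u hu =>
    continuous_primitive_snd (h := fun x s => p x s * u (x, s)) (by fun_prop) b
  -- For R ≥ |b| the ball of the maximum norm contains every segment from (s, b) to (s, η) with |s|,
  -- |η| ≤ R, so the inner integral never leaves it.
  obtain ⟨u, hu, he⟩ := exists_volterra_solution (R₀ := |b|)
    (T := fun u z => ∫ ξ' in (0 : ℝ)..z.1, ∫ η' in b..z.2, p ξ' η' * u (ξ', η')) (g := fun z => g z.1 z.2)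
    (fun u hu => by
      have h := hin u hu
      exact intervalIntegral.continuous_parametric_intervalIntegral_of_continuous
        (f := fun (z : ℝ × ℝ) ξ' => ∫ η' in b..z.2, p ξ' η' * u (ξ', η'))
        (h.comp (by fun_prop : Continuous fun q : (ℝ × ℝ) × ℝ => (q.2, q.1.2))) continuous_fst)
    (fun u v hu hv => by
      ext z
      simp only [Pi.add_apply]
      rw [← intervalIntegral.integral_add]
      · refine intervalIntegral.integral_congr fun ξ' _ => ?_
        rw [← intervalIntegral.integral_add]
        · refine intervalIntegral.integral_congr fun η' _ => ?_
          ring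
        · exact (by fun_prop : Continuous _).intervalIntegrable _ _
        · exact (by fun_prop : Continuous _).intervalIntegrable _ _
      · exact ((hin u hu).comp (by fun_prop : Continuous fun s : ℝ => (s, z.2))).intervalIntegrable _ _
      · exact ((hin v hv).comp (by fun_prop : Continuous fun s : ℝ => (s, z.2))).intervalIntegrable _ _)
    (fun R hR => by
      obtain ⟨K, hK⟩ := (isCompact_closedBall (0 : ℝ × ℝ) R).exists_bound_of_continuousOn hp.continuousOn
      have hR0 : 0 ≤ R := (abs_nonneg b).trans hR
      refine ⟨|K| * (2 * R), by positivity, fun u hu n c hc z hz => abs_integral_le_pow fun s hs => ?_⟩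
      have hz' : |z.1| ≤ R ∧ |z.2| ≤ R := by
        have := mem_closedBall_zero_iff.1 hz
        exact ⟨(norm_fst_le z).trans this, (norm_snd_le z).trans this⟩
      have hs' : |s| ≤ R := by
        have h1 : |s - 0| ≤ |z.1 - 0| := abs_sub_left_of_mem_uIcc hs
        simp only [sub_zero] at h1
        exact h1.trans hz'.1
      have hmem : ∀ t ∈ uIcc b z.2, (s, t) ∈ Metric.closedBall (0 : ℝ × ℝ) R := by
        intro t ht
        rw [mem_closedBall_zero_iff, Prod.norm_def, max_le_iff]
        refine ⟨hs', ?_⟩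
        have hR' : |b| ≤ R := hR
        rw [Real.norm_eq_abs, abs_le]
        rw [abs_le] at hR'
        rcases mem_uIcc.1 ht with h | h
        · constructor <;> linarith [h.1, h.2, hR'.1, (abs_le.1 hz'.2).2]
        · constructor <;> linarith [h.1, h.2, hR'.2, (abs_le.1 hz'.2).2, (abs_le.1 hz'.2).1]
      have hi : ‖∫ t in b..z.2, p s t * u (s, t)‖ ≤ |K| * (c * |s| ^ n) * |z.2 - b| := by
        refine intervalIntegral.norm_integral_le_of_norm_le_const fun t ht => ?_
        have hm := hmem t (uIoc_subset_uIcc ht)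
        rw [norm_mul]
        exact mul_le_mul ((hK _ hm).trans (le_abs_self K)) (hc _ hm) (norm_nonneg _) (abs_nonneg _)
      refine hi.trans ?_
      have h0 : 0 ≤ c * |s| ^ n := (abs_nonneg _).trans (hc (s, b) (hmem b left_mem_uIcc))
      have : |z.2 - b| ≤ 2 * R := (abs_sub _ _).trans (by linarith [hz'.2, (hR : |b| ≤ R)])
      calc |K| * (c * |s| ^ n) * |z.2 - b| ≤ |K| * (c * |s| ^ n) * (2 * R) := by gcongr
        _ = c * (|K| * (2 * R)) * |s| ^ n := by ring) hg
  exact ⟨fun ξ η => u (ξ, η), by simpa using hu, fun ξ η => he (ξ, η)⟩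

/-- The resolvent kernel of a Volterra integral operator. -/
theorem exists_resolvent_kernel {N : ℝ → ℝ → ℝ} (hN : Continuous fun z : ℝ × ℝ => N z.1 z.2) :
    ∃ L : ℝ → ℝ → ℝ, Continuous (fun z : ℝ × ℝ => L z.1 z.2) ∧
      ∀ x s, L x s = N x s + ∫ σ in s..x, N x σ * L σ s := by
  -- The unknown is u(x - s, s) = L(x, s). After the shift σ ↦ s + σ the integral starts at 0 for
  -- every s, and the gain is measured by |x - s|.
  obtain ⟨u, hu, he⟩ := exists_volterra_solution (R₀ := 0)
    (T := fun u z => ∫ σ in (0 : ℝ)..z.1, N (z.2 + z.1) (z.2 + σ) * u (σ, z.2))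
    (g := fun z => N (z.2 + z.1) z.2)
    (fun u hu => intervalIntegral.continuous_parametric_intervalIntegral_of_continuous
        (f := fun (z : ℝ × ℝ) σ => N (z.2 + z.1) (z.2 + σ) * u (σ, z.2)) (by fun_prop) continuous_fst)
    (fun u v hu hv => by
      ext z
      simp only [Pi.add_apply]
      rw [← intervalIntegral.integral_add]
      · refine intervalIntegral.integral_congr fun ξ' _ => ?_
        ring
      · exact (by fun_prop : Continuous _).intervalIntegrable _ _
      · exact (by fun_prop : Continuous _).intervalIntegrable _ _)
    (fun R hR => by
      obtain ⟨K, hK⟩ := (isCompact_closedBall (0 : ℝ × ℝ) (2 * R)).exists_bound_of_continuousOn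
        hN.continuousOn
      refine ⟨|K|, by positivity, fun u hu n c hc z hz => abs_integral_le_pow fun s hs => ?_⟩
      have hz' : |z.1| ≤ R ∧ |z.2| ≤ R := by
        have := mem_closedBall_zero_iff.1 hz
        exact ⟨(norm_fst_le z).trans this, (norm_snd_le z).trans this⟩
      have hs' : |s| ≤ R := by
        have h1 : |s - 0| ≤ |z.1 - 0| := abs_sub_left_of_mem_uIcc hs
        simp only [sub_zero] at h1
        exact h1.trans hz'.1
      have h1 := hK (z.2 + z.1, z.2 + s) (by
        rw [mem_closedBall_zero_iff, Prod.norm_def, max_le_iff]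
        exact ⟨(norm_add_le _ _).trans (by simp only [Real.norm_eq_abs]; linarith [hz'.1, hz'.2]),
          (norm_add_le _ _).trans (by simp only [Real.norm_eq_abs]; linarith [hz'.2])⟩)
      have h2 := hc (s, z.2) (by
        rw [mem_closedBall_zero_iff, Prod.norm_def, max_le_iff]
        exact ⟨hs', hz'.2⟩)
      rw [abs_mul]
      calc _ ≤ |K| * (c * |s| ^ n) := mul_le_mul (h1.trans (le_abs_self K)) h2 (abs_nonneg _) (abs_nonneg _)
        _ = c * |K| * |s| ^ n := by ring) (by fun_prop)
  refine ⟨fun x s => u (x - s, s), by fun_prop, fun x s => ?_⟩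
  simp only
  rw [he (x - s, s)]
  simp only [add_sub_cancel]
  congr 1
  have := intervalIntegral.integral_comp_sub_right (fun σ => N x (s + σ) * u (σ, s)) s (a := s) (b := x)
  simp only [sub_self, add_sub_cancel] at this
  exact this.symm

/-- Regularity of the solutions of the Goursat problem. -/
theorem goursat_regularity {p u : ℝ → ℝ → ℝ} {g₁ g₂ : ℝ → ℝ} {b : ℝ}
    (hp : ContDiff ℝ 1 fun z : ℝ × ℝ => p z.1 z.2) (hg₁ : ContDiff ℝ 2 g₁) (hg₂ : ContDiff ℝ 2 g₂)
    (hu : Continuous fun z : ℝ × ℝ => u z.1 z.2)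
    (he : ∀ ξ η, u ξ η = g₁ ξ + g₂ η + ∫ ξ' in (0 : ℝ)..ξ, ∫ η' in b..η, p ξ' η' * u ξ' η') :
    ContDiff ℝ 2 (fun z : ℝ × ℝ => u z.1 z.2) ∧
    (∀ ξ η, D₂ u ξ η = deriv g₂ η + ∫ ξ' in (0 : ℝ)..ξ, p ξ' η * u ξ' η) ∧
    (∀ ξ η, D₁ (D₂ u) ξ η = p ξ η * u ξ η) ∧ (∀ ξ η, D₂ (D₁ u) ξ η = p ξ η * u ξ η) := by
  have hpc := hp.continuous
  have hpu : Continuous fun z : ℝ × ℝ => p z.1 z.2 * u z.1 z.2 := hpc.mul hu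
  have hin := continuous_primitive_snd (h := fun x s => p x s * u x s) hpu b
  have d₁ : ∀ ξ η, HasDerivAt (fun ξ => u ξ η) (deriv g₁ ξ + ∫ η' in b..η, p ξ η' * u ξ η') ξ := by
    intro ξ η
    have h1 := ((hg₁.differentiable two_ne_zero ξ).hasDerivAt.add_const (g₂ η)).add
      (hasDerivAt_primitive (g := fun ξ' => ∫ η' in b..η, p ξ' η' * u ξ' η')
        (hin.comp (by fun_prop : Continuous fun s : ℝ => (s, η))) 0 ξ)
    exact h1.congr_of_eventuallyEq (Eventually.of_forall fun ξ => he ξ η)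
  -- With the order of integration exchanged, the η-derivative falls on an outer endpoint too.
  have he' : ∀ ξ η, u ξ η = g₁ ξ + g₂ η + ∫ η' in b..η, ∫ ξ' in (0 : ℝ)..ξ, p ξ' η' * u ξ' η' := by
    intro ξ η
    rw [he, intervalIntegral_intervalIntegral_swap]
    exact ((hpu.continuousOn (s := uIcc 0 ξ ×ˢ uIcc b η)).integrableOn_compact
      (isCompact_uIcc.prod isCompact_uIcc)).mono_set (prod_mono uIoc_subset_uIcc uIoc_subset_uIcc)
  have hsw : Continuous fun z : ℝ × ℝ => p z.2 z.1 * u z.2 z.1 := hpu.comp continuous_swap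
  have hin' := continuous_primitive_snd (h := fun y s => p s y * u s y) hsw 0
  have d₂ : ∀ ξ η, HasDerivAt (fun η => u ξ η) (deriv g₂ η + ∫ ξ' in (0 : ℝ)..ξ, p ξ' η * u ξ' η) η := by
    intro ξ η
    have h1 := ((hg₂.differentiable two_ne_zero η).hasDerivAt.const_add (g₁ ξ)).add
      (hasDerivAt_primitive (g := fun η' => ∫ ξ' in (0 : ℝ)..ξ, p ξ' η' * u ξ' η')
        (hin'.comp (by fun_prop : Continuous fun s : ℝ => (s, ξ))) b η)
    exact h1.congr_of_eventuallyEq (Eventually.of_forall fun η => he' ξ η)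
  have hg₁' : ContDiff ℝ 1 (deriv g₁) := (contDiff_succ_iff_deriv (n := 1).1 (by exact_mod_cast hg₁)).2.2
  have hg₂' : ContDiff ℝ 1 (deriv g₂) := (contDiff_succ_iff_deriv (n := 1).1 (by exact_mod_cast hg₂)).2.2
  have hg₁c := hg₁'.continuous
  have hg₂c := hg₂'.continuous
  have c₁ : ContDiff ℝ 1 fun z : ℝ × ℝ => u z.1 z.2 := by
    have := contDiff_succ_of_partial (n := 0) d₁ d₂ (contDiff_zero.2 (by fun_prop))
      (contDiff_zero.2 ((hg₂c.comp continuous_snd).add (hin'.comp continuous_swap)))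
    simpa using this
  -- Bootstrap: once u is C¹, the integrands in the formulas for its partial derivatives are C¹,
  -- hence u is C².
  have hpu1 : ContDiff ℝ 1 fun z : ℝ × ℝ => p z.1 z.2 * u z.1 z.2 := hp.mul c₁
  have i₁ := contDiff_one_primitive_snd (h := fun x s => p x s * u x s) hpu1 b
  have i₂ := contDiff_one_primitive_snd (h := fun y s => p s y * u s y)
    (hpu1.comp (contDiff_snd.prodMk contDiff_fst)) 0
  have c₂ := contDiff_succ_of_partial (n := 1) d₁ d₂
    ((hg₁'.comp contDiff_fst).add i₁)
    ((hg₂'.comp contDiff_snd).add (i₂.comp (contDiff_snd.prodMk contDiff_fst)))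
  have hD₂ : ∀ ξ η, D₂ u ξ η = deriv g₂ η + ∫ ξ' in (0 : ℝ)..ξ, p ξ' η * u ξ' η :=
    fun ξ η => (d₂ ξ η).deriv
  have hD₁ : ∀ ξ η, D₁ u ξ η = deriv g₁ ξ + ∫ η' in b..η, p ξ η' * u ξ η' :=
    fun ξ η => (d₁ ξ η).deriv
  refine ⟨c₂, hD₂, fun ξ η => ?_, fun ξ η => ?_⟩
  · have := (hasDerivAt_primitive (g := fun s => p s η * u s η) (by fun_prop) 0 ξ).const_add (deriv g₂ η)
    simp only [D₁, hD₂]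
    exact this.deriv
  · have := (hasDerivAt_primitive (g := fun s => p ξ s * u ξ s) (by fun_prop) b η).const_add (deriv g₁ ξ)
    simp only [D₂, hD₁]
    exact this.deriv

theorem integral_eq_zero_of_forall_uIcc {f : ℝ → ℝ} {a b : ℝ} (h : ∀ x ∈ uIcc a b, f x = 0) :
    ∫ x in a..b, f x = 0 := by
  rw [intervalIntegral.integral_congr (g := fun _ => 0) h]
  simp

/-! ### The kernel in characteristic coordinates `ξ = x + t`, `η = x - t` -/

/-- With a potential on the whole line the Goursat problem lives on the whole plane, and no boundary
enters its regularity. Freezing q' at its value at 0 gives a C¹ extension, which is all that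
`goursat_regularity` needs. -/
theorem exists_contDiff_one_extension {q : ℝ → ℝ} (hq : ContDiffOn ℝ 1 q (Ici 0)) :
    ∃ Q : ℝ → ℝ, ContDiff ℝ 1 Q ∧ ∀ x, 0 ≤ x → Q x = q x := by
  have hd : ContinuousOn (derivWithin q (Ici 0)) (Ici 0) :=
    hq.continuousOn_derivWithin (uniqueDiffOn_Ici (0 : ℝ)) le_rfl
  set D : ℝ → ℝ := fun s => derivWithin q (Ici 0) (max s 0) with hD
  have hDc : Continuous D := by
    refine hd.comp_continuous (by fun_prop) fun s => ?_
    exact le_max_right s 0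
  have hder := fun x => (hasDerivAt_primitive hDc 0 x).const_add (q 0)
  refine ⟨fun x => q 0 + ∫ s in (0 : ℝ)..x, D s, ?_, fun x hx => ?_⟩
  · rw [contDiff_one_iff_deriv]
    refine ⟨fun x => (hder x).differentiableAt, ?_⟩
    have : deriv (fun x => q 0 + ∫ s in (0 : ℝ)..x, D s) = D := funext fun x => (hder x).deriv
    rw [this]
    exact hDc
  · have h := intervalIntegral.integral_eq_sub_of_hasDeriv_right_of_le hx
      (f := q) (hq.continuousOn.mono Icc_subset_Ici_self) (f' := D) (fun s hs => ?_) (hDc.intervalIntegrable _ _)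
    · simp only [h]; ring
    · have h1 := (hq.differentiableOn one_ne_zero s hs.1.le).hasDerivWithinAt
      have h2 : D s = derivWithin q (Ici 0) s := by simp only [hD]; rw [max_eq_left hs.1.le]
      rw [h2]
      exact h1.mono (fun z hz => le_of_lt (lt_of_le_of_lt hs.1.le hz))

/-- `G` is the regular part of the fundamental solution for the potential `Q`, written in
characteristic coordinates. -/
structure IsGoursatKernel (Q : ℝ → ℝ) (a : ℝ) (G : ℝ → ℝ → ℝ) : Prop where
  contDiff : ContDiff ℝ 2 fun p : ℝ × ℝ => G p.1 p.2
  mixed : ∀ ξ η, D₁ (D₂ G) ξ η = Q ((ξ + η) / 2) / 4 * G ξ η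
  D₂_boundary : ∀ η, D₂ G 0 η = Q (η / 2) / 4
  D₂_eq_zero : ∀ ξ η, 0 ≤ ξ → 2 * a ≤ η → D₂ G ξ η = 0
  eq_zero : ∀ ξ η, 0 ≤ ξ → 2 * a ≤ η → G ξ η = 0
  eq_const : ∀ ξ η, 0 ≤ ξ → 0 ≤ η → 2 * a ≤ ξ + η → G ξ η = G (2 * a) η

/-- The integration starts at the corner (0, 2a). Since the coefficient vanishes for ξ + η ≥ 2a,
nothing accumulates for ξ ≥ 0, η ≥ 2a, and for fixed 0 ≤ η < 2a nothing changes in ξ beyond 2a - η.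
-/
theorem exists_goursatKernel {Q : ℝ → ℝ} {a : ℝ} (hQ : ContDiff ℝ 1 Q) (ha : 0 ≤ a)
    (hQa : ∀ x, a ≤ x → Q x = 0) : ∃ G, IsGoursatKernel Q a G := by
  have hp : ContDiff ℝ 1 fun z : ℝ × ℝ => Q ((z.1 + z.2) / 2) / 4 := by fun_prop
  have hQc := hQ.continuous
  set g : ℝ → ℝ := fun η => ∫ s in (2 * a)..η, Q (s / 2) / 4 with hg
  have hgd : ∀ η, HasDerivAt g (Q (η / 2) / 4) η := fun η =>
    hasDerivAt_primitive (g := fun s => Q (s / 2) / 4) (by fun_prop) _ η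
  have hgd' : deriv g = fun η => Q (η / 2) / 4 := funext fun η => (hgd η).deriv
  have hg2 : ContDiff ℝ 2 g := by
    have : ContDiff ℝ (1 + 1) g := by
      rw [contDiff_succ_iff_deriv]
      refine ⟨fun η => (hgd η).differentiableAt, by simp, ?_⟩
      rw [hgd']; fun_prop
    exact_mod_cast this
  obtain ⟨G, hGc, hG⟩ := exists_goursat_solution (p := fun ξ η => Q ((ξ + η) / 2) / 4) hp.continuous (2 * a)
    (g := fun _ η => g η) (hg2.continuous.comp continuous_snd)
  obtain ⟨h2, hD2, hD12, -⟩ := goursat_regularity (g₁ := fun _ => 0) (g₂ := g) (b := 2 * a) hp contDiff_const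
    hg2 hGc (fun ξ η => by rw [hG ξ η]; ring)
  have hz : ∀ ξ η, 0 ≤ ξ → 2 * a ≤ η → G ξ η = 0 := by
    intro ξ η hξ hη
    rw [hG, hg]
    simp only
    rw [integral_eq_zero_of_forall_uIcc, integral_eq_zero_of_forall_uIcc, add_zero]
    · intro ξ' hξ'
      rw [uIcc_of_le hξ] at hξ'
      refine integral_eq_zero_of_forall_uIcc fun η' hη' => ?_
      rw [uIcc_of_le hη] at hη'
      rw [hQa _ (by linarith [hξ'.1, hη'.1])]; ring
    · intro s hs
      rw [uIcc_of_le hη] at hs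
      rw [hQa _ (by linarith [hs.1])]; ring
  refine ⟨G, h2, hD12, fun η => ?_, fun ξ η hξ hη => ?_, hz, fun ξ η hξ hη hs => ?_⟩
  · rw [hD2, hgd']; simp
  · rw [hD2, hgd']
    simp only
    rw [hQa _ (by linarith), integral_eq_zero_of_forall_uIcc]
    · simp
    · intro s hs
      rw [uIcc_of_le hξ] at hs
      rw [hQa _ (by linarith [hs.1])]; ring
  · rcases le_or_gt (2 * a) η with h | h
    · rw [hz _ _ hξ h, hz _ _ (by linarith) h]
    · rw [hG ξ, hG (2 * a)]
      congr 1
      rw [← sub_eq_zero]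
      have hin := continuous_primitive_snd (h := fun x s => Q ((x + s) / 2) / 4 * G x s)
        (hp.continuous.mul hGc) (2 * a)
      have hc : Continuous fun ξ' => ∫ η' in (2 * a)..η, Q ((ξ' + η') / 2) / 4 * G ξ' η' :=
        hin.comp (by fun_prop : Continuous fun s : ℝ => (s, η))
      rw [intervalIntegral.integral_interval_sub_left (hc.intervalIntegrable _ _)
        (hc.intervalIntegrable _ _)]
      refine integral_eq_zero_of_forall_uIcc fun ξ' hξ' =>
        integral_eq_zero_of_forall_uIcc fun η' hη' => ?_
      rw [uIcc_of_ge h.le] at hη'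
      rw [hQa _ ?_]
      · ring
      · rcases mem_uIcc.1 hξ' with h' | h' <;> linarith [h'.1, hη'.1]

namespace IsGoursatKernel
variable {Q : ℝ → ℝ} {a : ℝ} {G : ℝ → ℝ → ℝ}

/-- The transposed control operator turns solutions of the wave equation with potential `Q` into
solutions of the free wave equation. -/
theorem intertwining (hG : IsGoursatKernel Q a G) (ha : 0 ≤ a) {Φ : ℝ → ℝ → ℝ} {δ : ℝ} (hδ : 0 ≤ δ)
    (hΦ : ContDiff ℝ 2 fun p : ℝ × ℝ => Φ p.1 p.2)
    (hmix : ∀ ξ η, δ < ξ + η → D₁ (D₂ Φ) ξ η = Q ((ξ + η) / 2) / 4 * Φ ξ η)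
    {ξ η ξ' η' : ℝ} (hs : δ < ξ + η) (hξ : ξ ≤ ξ') (hη : η ≤ η')
    (h1 : 2 * a ≤ ξ + η') (h2 : 2 * a ≤ ξ' + η) :
    Φ ξ η + ∫ σ in (0 : ℝ)..(2 * a), G σ (σ + ξ + η) * Φ (ξ + σ) (η + σ) =
      Φ ξ η' + Φ ξ' η - Φ ξ' η' := by
  have cG := hG.contDiff.continuous
  have cΦ := hΦ.continuous
  have oG : ContDiff ℝ 1 fun p : ℝ × ℝ => G p.1 p.2 := hG.contDiff.of_le (by norm_num)
  have oΦ : ContDiff ℝ 1 fun p : ℝ × ℝ => Φ p.1 p.2 := hΦ.of_le (by norm_num)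
  have oG2 : ContDiff ℝ 1 fun p : ℝ × ℝ => D₂ G p.1 p.2 := contDiff_D₂ (n := 1) (by exact_mod_cast hG.contDiff)
  have oΦ2 : ContDiff ℝ 1 fun p : ℝ × ℝ => D₂ Φ p.1 p.2 := contDiff_D₂ (n := 1) (by exact_mod_cast hΦ)
  have cΦ1 : Continuous fun p : ℝ × ℝ => D₁ Φ p.1 p.2 := (contDiff_D₁ (n := 0) (by exact_mod_cast oΦ)).continuous
  have cG2 := oG2.continuous
  have cΦ2 := oΦ2.continuous
  have cG22 : Continuous fun p : ℝ × ℝ => D₂ (D₂ G) p.1 p.2 := (contDiff_D₂ (n := 0) (by exact_mod_cast oG2)).continuous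
  have cΦ12 : Continuous fun p : ℝ × ℝ => D₁ (D₂ Φ) p.1 p.2 := (contDiff_D₁ (n := 0) (by exact_mod_cast oΦ2)).continuous
  set Z : ℝ → ℝ → ℝ := fun ξ η => D₂ Φ ξ η + ∫ σ in (0 : ℝ)..(2 * a),
    (D₂ G σ (σ + ξ + η) * Φ (ξ + σ) (η + σ) + G σ (σ + ξ + η) * D₂ Φ (ξ + σ) (η + σ)) with hZ
  set Ψ : ℝ → ℝ → ℝ := fun ξ η => Φ ξ η + ∫ σ in (0 : ℝ)..(2 * a), G σ (σ + ξ + η) * Φ (ξ + σ) (η + σ)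
    with hΨ
  have dΨ : ∀ ξ η, HasDerivAt (fun η => Ψ ξ η) (Z ξ η) η := by
    intro ξ η
    refine (hasDerivAt_D₂ oΦ ξ η).add (hasDerivAt_parametric
      (h := fun η σ => G σ (σ + ξ + η) * Φ (ξ + σ) (η + σ))
      (h₁ := fun η σ => D₂ G σ (σ + ξ + η) * Φ (ξ + σ) (η + σ) + G σ (σ + ξ + η) * D₂ Φ (ξ + σ) (η + σ))
      (by fun_prop) (by fun_prop) (fun η σ => ?_) _ _ _)
    have e1 := hasDerivAt_comp₂ oG (hasDerivAt_const η σ) ((hasDerivAt_id η).const_add (σ + ξ))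
    have e2 := hasDerivAt_comp₂ oΦ (hasDerivAt_const η (ξ + σ)) ((hasDerivAt_id η).add_const σ)
    refine (e1.mul e2).congr_deriv ?_
    simp only [id]; ring
  -- The integrand of Z_ξ is the total σ-derivative of G_η(σ, σ + ξ + η) Φ(ξ + σ, η + σ): the terms
  -- G_ξη Φ and G Φ_ξη agree because both factors solve the same equation at the same x. The
  -- boundary term at σ = 2a vanishes, and the one at σ = 0 cancels Φ_ξη.
  have dZ : ∀ ξ η, δ < ξ + η → HasDerivAt (fun ξ => Z ξ η) 0 ξ := by
    intro ξ η hs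
    have e := (hasDerivAt_D₁ oΦ2 ξ η).add (hasDerivAt_parametric
      (h := fun ξ σ => D₂ G σ (σ + ξ + η) * Φ (ξ + σ) (η + σ) + G σ (σ + ξ + η) * D₂ Φ (ξ + σ) (η + σ))
      (h₁ := fun ξ σ => (D₂ (D₂ G) σ (σ + ξ + η) * Φ (ξ + σ) (η + σ)
          + D₂ G σ (σ + ξ + η) * D₁ Φ (ξ + σ) (η + σ))
        + (D₂ G σ (σ + ξ + η) * D₂ Φ (ξ + σ) (η + σ) + G σ (σ + ξ + η) * D₁ (D₂ Φ) (ξ + σ) (η + σ)))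
      (by fun_prop) (by fun_prop) (fun ξ σ => ?_) 0 (2 * a) ξ)
    · refine e.congr_deriv ?_
      rw [intervalIntegral.integral_eq_sub_of_hasDerivAt
        (f := fun σ => D₂ G σ (σ + ξ + η) * Φ (ξ + σ) (η + σ))]
      · have z1 : D₂ G (2 * a) (2 * a + ξ + η) = 0 := hG.D₂_eq_zero _ _ (by linarith) (by linarith)
        simp only [z1, zero_add, add_zero, hG.D₂_boundary, hmix ξ η hs]
        ring
      · intro σ hσ
        rw [uIcc_of_le (by linarith)] at hσ
        have e1 := hasDerivAt_comp₂ oG2 (hasDerivAt_id σ) (((hasDerivAt_id σ).add_const ξ).add_const η)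
        have e2 := hasDerivAt_comp₂ oΦ ((hasDerivAt_id σ).const_add ξ) ((hasDerivAt_id σ).const_add η)
        refine (e1.mul e2).congr_deriv ?_
        simp only [id]
        rw [hmix _ _ (by linarith [hσ.1]), hG.mixed,
          show (σ + (σ + ξ + η)) / 2 = (ξ + σ + (η + σ)) / 2 by ring]
        ring
      · exact (by fun_prop : Continuous _).intervalIntegrable _ _
    · have e1 := hasDerivAt_comp₂ oG (hasDerivAt_const ξ σ) (((hasDerivAt_id ξ).const_add σ).add_const η)
      have e1' := hasDerivAt_comp₂ oG2 (hasDerivAt_const ξ σ) (((hasDerivAt_id ξ).const_add σ).add_const η)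
      have e2 := hasDerivAt_comp₂ oΦ ((hasDerivAt_id ξ).add_const σ) (hasDerivAt_const ξ (η + σ))
      have e2' := hasDerivAt_comp₂ oΦ2 ((hasDerivAt_id ξ).add_const σ) (hasDerivAt_const ξ (η + σ))
      refine ((e1'.mul e2).add (e1.mul e2')).congr_deriv ?_
      simp only [id]; ring
  -- Integrating Ψ_ξη = 0 over the rectangle, first in ξ and then in η, gives the parallelogram
  -- identity.
  have hZc : ∀ η₀ ≥ η, Z ξ' η₀ = Z ξ η₀ := by
    intro η₀ hη₀
    refine constant_of_has_deriv_right_zero (f := fun ξ => Z ξ η₀) (a := ξ) (b := ξ')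
      (fun t ht => (dZ t η₀ (by linarith [ht.1])).continuousAt.continuousWithinAt)
      (fun t ht => (dZ t η₀ (by linarith [ht.1])).hasDerivWithinAt) ξ' ⟨hξ, le_rfl⟩
  have hΨc : Ψ ξ' η' - Ψ ξ η' = Ψ ξ' η - Ψ ξ η := by
    refine constant_of_has_deriv_right_zero (f := fun η => Ψ ξ' η - Ψ ξ η) (a := η) (b := η')
      (fun t _ => ((dΨ ξ' t).sub (dΨ ξ t)).continuousAt.continuousWithinAt)
      (fun t ht => ?_) η' ⟨hη, le_rfl⟩
    have := (dΨ ξ' t).sub (dΨ ξ t)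
    rw [hZc t ht.1, sub_self] at this
    exact this.hasDerivWithinAt
  have hfar : ∀ ξ η, 2 * a ≤ ξ + η → Ψ ξ η = Φ ξ η := by
    intro ξ η h
    simp only [hΨ]
    rw [integral_eq_zero_of_forall_uIcc, add_zero]
    · intro σ hσ
      rw [uIcc_of_le (by linarith)] at hσ
      rw [hG.eq_zero _ _ hσ.1 (by linarith [hσ.1]), zero_mul]
  rw [hfar _ _ (by linarith), hfar _ _ h1, hfar _ _ h2] at hΨc
  change Ψ ξ η = _
  linarith

/-- Substitution x = τ + σ. The endpoint τ + 2a can be traded for B because the kernel vanishes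
between them, where x + τ ≥ 2a. -/
theorem integral_shift (hG : IsGoursatKernel Q a G) (ha : 0 ≤ a) {f : ℝ → ℝ} (hf : Continuous f)
    {τ B : ℝ} (hτ : 0 ≤ τ) (hB : 2 * a ≤ B) (hτB : τ ≤ B) :
    ∫ σ in (0 : ℝ)..(2 * a), G σ (σ + 2 * τ) * f (τ + σ) = ∫ x in τ..B, G (x - τ) (x + τ) * f x := by
  have cG := hG.contDiff.continuous
  have e := intervalIntegral.integral_comp_add_left
    (fun x => G (x - τ) (x + τ) * f x) τ (a := 0) (b := 2 * a)
  rw [add_zero] at e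
  have e2 : ∫ σ in (0 : ℝ)..(2 * a), G σ (σ + 2 * τ) * f (τ + σ) =
      ∫ σ in (0 : ℝ)..(2 * a), G (τ + σ - τ) (τ + σ + τ) * f (τ + σ) := by
    refine intervalIntegral.integral_congr fun σ _ => ?_
    ring_nf
  rw [e2, e, ← sub_eq_zero]
  have ci : Continuous fun x => G (x - τ) (x + τ) * f x := by fun_prop
  rw [intervalIntegral.integral_interval_sub_left (ci.intervalIntegrable _ _)
    (ci.intervalIntegrable _ _)]
  refine integral_eq_zero_of_forall_uIcc fun x hx => ?_
  rw [hG.eq_zero (x - τ) (x + τ) _ _, zero_mul]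
  all_goals rcases mem_uIcc.1 hx with h' | h' <;> linarith [h'.1]

/-- The kernel of the transposed control operator composed with the control operator is of Hankel type. -/
theorem hankel (hG : IsGoursatKernel Q a G) (ha : 0 ≤ a) {τ s B : ℝ} (hs : 0 ≤ s) (hsτ : s ≤ τ)
    (hτ : 0 < τ) (hB : 2 * a ≤ B) (hτB : τ ≤ B) :
    G (τ - s) (τ + s) + ∫ x in τ..B, G (x - s) (x + s) * G (x - τ) (x + τ) = G (2 * a) (τ + s) := by
  have cG := hG.contDiff.continuous
  -- The rectangle has sides 2a. Its two corners with the larger η lie where G = 0, and the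
  -- remaining far corner gives G(2a, τ + s).
  have h := hG.intertwining ha (Φ := G) (δ := 0) le_rfl hG.contDiff (fun ξ η _ => hG.mixed ξ η)
    (ξ := τ - s) (η := τ + s) (ξ' := τ - s + 2 * a) (η' := τ + s + 2 * a) (by linarith) (by linarith)
    (by linarith) (by linarith) (by linarith)
  rw [hG.eq_zero _ (τ + s + 2 * a) (by linarith) (by linarith),
    hG.eq_zero _ (τ + s + 2 * a) (by linarith) (by linarith),
    hG.eq_const (τ - s + 2 * a) _ (by linarith) (by linarith) (by linarith)] at h
  rw [zero_add, sub_zero] at h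
  rw [← h, intervalIntegral.integral_congr
    (g := fun x => G (x - τ) (x + τ) * G (x - s) (x + s)) (fun x _ => mul_comm _ _),
    ← hG.integral_shift ha (f := fun x => G (x - s) (x + s)) (by fun_prop) hτ.le hB hτB]
  congr 1
  refine intervalIntegral.integral_congr fun σ _ => ?_
  ring_nf

end IsGoursatKernel

/-- A smooth map of the line into `(0, ∞)` that is the identity on `[δ, ∞)`. -/
theorem exists_smooth_retraction {δ : ℝ} (hδ : 0 < δ) :
    ∃ χ : ℝ → ℝ, ContDiff ℝ ∞ χ ∧ (∀ x, 0 < χ x) ∧ ∀ x, δ ≤ x → χ x = x := by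
  have hs : ContDiff ℝ ∞ fun x : ℝ => Real.smoothTransition (2 * x / δ - 1) :=
    Real.smoothTransition.contDiff.comp (by fun_prop)
  refine ⟨fun x => Real.smoothTransition (2 * x / δ - 1) * x
    + (1 - Real.smoothTransition (2 * x / δ - 1)) * δ, by fun_prop, fun x => ?_, fun x hx => ?_⟩
  · beta_reduce
    rcases le_or_gt x (δ / 2) with h | h
    · rw [Real.smoothTransition.zero_of_nonpos]
      · simpa using hδ
      · rw [sub_nonpos, div_le_one hδ]; linarith
    · have h0 := Real.smoothTransition.nonneg (2 * x / δ - 1)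
      have h1 := Real.smoothTransition.le_one (2 * x / δ - 1)
      nlinarith
  · simp only
    rw [Real.smoothTransition.one_of_one_le]
    · ring
    · rw [le_sub_iff_add_le, le_div_iff₀ hδ]; linarith

/-- The differential equation expresses y'' through y and the continuous Q. -/
theorem IsSpecialTarget.contDiffOn_two {Q q : ℝ → ℝ} {a k : ℝ} {y : ℝ → ℝ}
    (hy : IsSpecialTarget q a k y) (hQ : Continuous Q) (hQq : ∀ x, 0 ≤ x → Q x = q x) :
    ContDiffOn ℝ 2 y (Ioi 0) := by
  have h1 : ContDiffOn ℝ 1 (deriv y) (Ioi 0) := by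
    have h : ContDiffOn ℝ (0 + 1) (deriv y) (Ioi 0) := by
      rw [contDiffOn_succ_iff_deriv_of_isOpen isOpen_Ioi]
      refine ⟨hy.differentiableOn_deriv, by simp, ?_⟩
      rw [contDiffOn_zero]
      refine ContinuousOn.congr (f := fun x => Q x * y x + k ^ 2 * y x)
        ((hQ.continuousOn.mul hy.differentiableOn.continuousOn).add
          (continuousOn_const.mul hy.differentiableOn.continuousOn)) fun x hx => ?_
      have := hy.ode x hx
      simp only
      rw [hQq x (le_of_lt hx)]
      linarith
    simpa using h
  have h : ContDiffOn ℝ (1 + 1) y (Ioi 0) := by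
    rw [contDiffOn_succ_iff_deriv_of_isOpen isOpen_Ioi]
    exact ⟨hy.differentiableOn, by simp, h1⟩
  exact_mod_cast h

/-- The transposed control operator maps the special target to the exponential. -/
theorem IsGoursatKernel.transform_target {Q q : ℝ → ℝ} {a : ℝ} {G : ℝ → ℝ → ℝ}
    (hG : IsGoursatKernel Q a G) (ha : 0 ≤ a)
    (hQ : Continuous Q) (hQq : ∀ x, 0 ≤ x → Q x = q x) {k : ℝ} {y : ℝ → ℝ}
    (hy : IsSpecialTarget q a k y) {τ : ℝ} (hτ : 0 < τ) {B : ℝ} (hB : 2 * a ≤ B) (hτB : τ ≤ B) :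
    y τ + ∫ x in τ..B, G (x - τ) (x + τ) * y x = Real.exp (-k * τ) := by
  -- Nothing is known of y at x ≤ 0. Composition with χ makes it C² on the line without changing it
  -- for x ≥ τ/2, that is, for ξ + η ≥ τ.
  obtain ⟨χ, hχ, hχ0, hχδ⟩ := exists_smooth_retraction (δ := τ / 2) (by linarith)
  have hy2 : ContDiffOn ℝ 2 y (Ioi 0) := hy.contDiffOn_two hQ hQq
  have hyχ : ContDiff ℝ 2 fun x => y (χ x) := by
    rw [← contDiffOn_univ]
    exact hy2.comp (contDiff_infty.1 hχ 2).contDiffOn (fun x _ => hχ0 x)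
  have hyχc := hyχ.continuous
  -- This is e^{kt} y(x), a solution of the wave equation because y'' = (q + k²) y.
  set Φ : ℝ → ℝ → ℝ := fun ξ η => Real.exp (k * ((ξ - η) / 2)) * y (χ ((ξ + η) / 2)) with hΦ
  have hΦ2 : ContDiff ℝ 2 fun p : ℝ × ℝ => Φ p.1 p.2 :=
    (Real.contDiff_exp.comp (by fun_prop)).mul (hyχ.comp (by fun_prop))
  have hloc : ∀ x, τ / 2 < x → (fun x => y (χ x)) =ᶠ[𝓝 x] y := fun x hx => by
    filter_upwards [Ioi_mem_nhds hx] with z hz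
    rw [hχδ z (le_of_lt hz)]
  have hd1 : ∀ x, τ / 2 < x → HasDerivAt (fun x => y (χ x)) (deriv y x) x := fun x hx =>
    ((hy.differentiableOn x (by simp only [mem_Ioi]; linarith)).differentiableAt
      (Ioi_mem_nhds (by linarith))).hasDerivAt.congr_of_eventuallyEq (hloc x hx)
  have hd2 : ∀ x, τ / 2 < x → HasDerivAt (deriv y) (deriv (deriv y) x) x := fun x hx =>
    ((hy.differentiableOn_deriv x (by simp only [mem_Ioi]; linarith)).differentiableAt
      (Ioi_mem_nhds (by linarith))).hasDerivAt
  have hD2 : ∀ ξ η, τ < ξ + η → D₂ Φ ξ η = Real.exp (k * ((ξ - η) / 2)) *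
      (-(k / 2) * y (χ ((ξ + η) / 2)) + 1 / 2 * deriv y ((ξ + η) / 2)) := by
    intro ξ η h
    have e1 := ((((hasDerivAt_id η).const_sub ξ).div_const 2).const_mul k).exp
    have e2 := (hd1 ((ξ + η) / 2) (by linarith)).comp η (((hasDerivAt_id η).const_add ξ).div_const 2)
    refine ((e1.mul e2).deriv).trans ?_
    simp only [id, Function.comp]; ring
  have hmix : ∀ ξ η, τ < ξ + η → D₁ (D₂ Φ) ξ η = Q ((ξ + η) / 2) / 4 * Φ ξ η := by
    intro ξ η h
    have hev : (fun ξ => D₂ Φ ξ η) =ᶠ[𝓝 ξ] fun ξ => Real.exp (k * ((ξ - η) / 2)) *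
        (-(k / 2) * y (χ ((ξ + η) / 2)) + 1 / 2 * deriv y ((ξ + η) / 2)) := by
      filter_upwards [Ioi_mem_nhds (show τ - η < ξ by linarith)] with ξ' hξ'
      exact hD2 ξ' η (by simp only [mem_Ioi] at hξ'; linarith)
    have e1 := ((((hasDerivAt_id ξ).sub_const η).div_const 2).const_mul k).exp
    have e2 := (hd1 ((ξ + η) / 2) (by linarith)).comp ξ (((hasDerivAt_id ξ).add_const η).div_const 2)
    have e3 := (hd2 ((ξ + η) / 2) (by linarith)).comp ξ (((hasDerivAt_id ξ).add_const η).div_const 2)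
    have e4 := e1.mul ((e2.const_mul (-(k / 2))).add (e3.const_mul (1 / 2)))
    have hode := hy.ode ((ξ + η) / 2) (by linarith)
    rw [← hQq _ (by linarith)] at hode
    simp only [D₁]
    rw [hev.deriv_eq]
    refine e4.deriv.trans ?_
    simp only [id, Function.comp, hΦ, Pi.add_apply]
    rw [hχδ _ (by linarith : τ / 2 ≤ (ξ + η) / 2), show deriv (deriv y) ((ξ + η) / 2)
      = Q ((ξ + η) / 2) * y ((ξ + η) / 2) + k ^ 2 * y ((ξ + η) / 2) by linarith]
    ring
  have hfar : ∀ ξ η, τ ≤ ξ + η → 2 * a < ξ + η → Φ ξ η = Real.exp (-k * η) := by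
    intro ξ η h1 h2
    simp only [hΦ]
    rw [hχδ _ (by linarith), hy.eq_exp _ (by linarith), ← Real.exp_add]
    congr 1; ring
  -- The added 1 puts the far corners strictly beyond x = a, where y is the exponential.
  have h := hG.intertwining ha hτ.le hΦ2 hmix (ξ := τ) (η := τ) (ξ' := τ + 2 * a + 1)
    (η' := τ + 2 * a + 1) (by linarith) (by linarith) (by linarith) (by linarith) (by linarith)
  rw [hfar τ (τ + 2 * a + 1) (by linarith) (by linarith),
    hfar (τ + 2 * a + 1) τ (by linarith) (by linarith),
    hfar (τ + 2 * a + 1) (τ + 2 * a + 1) (by linarith) (by linarith)] at h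
  have e1 : Φ τ τ = y τ := by
    simp only [hΦ]
    rw [sub_self, zero_div, mul_zero, Real.exp_zero, one_mul, hχδ _ (by linarith)]
    congr 1; ring
  have e2 : ∫ σ in (0 : ℝ)..(2 * a), G σ (σ + τ + τ) * Φ (τ + σ) (τ + σ) =
      ∫ σ in (0 : ℝ)..(2 * a), G σ (σ + 2 * τ) * y (χ (τ + σ)) := by
    refine intervalIntegral.integral_congr fun σ _ => ?_
    simp only [hΦ]
    rw [sub_self, zero_div, mul_zero, Real.exp_zero, one_mul]
    ring_nf
  rw [e1, e2, hG.integral_shift ha hyχc hτ.le hB hτB] at h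
  have e3 : ∫ x in τ..B, G (x - τ) (x + τ) * y x = ∫ x in τ..B, G (x - τ) (x + τ) * y (χ x) := by
    refine intervalIntegral.integral_congr fun x hx => ?_
    rw [uIcc_of_le hτB] at hx
    rw [hχδ x (by linarith [hx.1])]
  rw [e3, h]
  ring

/-! ### The fundamental solution -/

/-- The Duhamel integral U itself solves a Goursat integral equation with datum f, so
`goursat_regularity` supplies both its C² smoothness and the wave equation. For η ≥ 2a it equals
f(ξ), so the incident limit is attained at finite s. -/
theorem IsGoursatKernel.isClassicalWave {Q q : ℝ → ℝ} {a : ℝ} {G : ℝ → ℝ → ℝ}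
    (hG : IsGoursatKernel Q a G) (hQ : ContDiff ℝ 1 Q) (hQq : ∀ x, 0 ≤ x → Q x = q x)
    {f : ℝ → ℝ} (hf : ContDiff ℝ ∞ f) (hf0 : ∀ τ ≤ 0, f τ = 0) :
    IsClassicalWave q f (duhamel (fun x t => G (x + t) (x - t)) f) := by
  have hfc := hf.continuous
  have cG := hG.contDiff.continuous
  have oG : ContDiff ℝ 1 fun p : ℝ × ℝ => G p.1 p.2 := hG.contDiff.of_le (by norm_num)
  have oG2 : ContDiff ℝ 1 fun p : ℝ × ℝ => D₂ G p.1 p.2 := contDiff_D₂ (n := 1) (by exact_mod_cast hG.contDiff)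
  have cG2 := oG2.continuous
  have cG12 : Continuous fun p : ℝ × ℝ => D₁ (D₂ G) p.1 p.2 := (contDiff_D₁ (n := 0) (by exact_mod_cast oG2)).continuous
  have hQc := hQ.continuous
  have hp : ContDiff ℝ 1 fun z : ℝ × ℝ => Q ((z.1 + z.2) / 2) / 4 := by fun_prop
  set U : ℝ → ℝ → ℝ := fun ξ η => f ξ + ∫ s in (0 : ℝ)..ξ, G (ξ - s) (η + s) * f s with hU
  set V : ℝ → ℝ → ℝ := fun ξ η => ∫ s in (0 : ℝ)..ξ, D₂ G (ξ - s) (η + s) * f s with hV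
  have hUc : Continuous fun z : ℝ × ℝ => U z.1 z.2 := by
    refine (hfc.comp continuous_fst).add ?_
    exact intervalIntegral.continuous_parametric_intervalIntegral_of_continuous
      (f := fun (z : ℝ × ℝ) s => G (z.1 - s) (z.2 + s) * f s) (by fun_prop) continuous_fst
  have hVc : Continuous fun z : ℝ × ℝ => V z.1 z.2 := by
    exact intervalIntegral.continuous_parametric_intervalIntegral_of_continuous
      (f := fun (z : ℝ × ℝ) s => D₂ G (z.1 - s) (z.2 + s) * f s) (by fun_prop) continuous_fst
  have dU : ∀ ξ η, HasDerivAt (fun η => U ξ η) (V ξ η) η := by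
    intro ξ η
    refine (hasDerivAt_parametric (h := fun η s => G (ξ - s) (η + s) * f s)
      (h₁ := fun η s => D₂ G (ξ - s) (η + s) * f s) (by fun_prop) (by fun_prop)
      (fun η s => ?_) 0 ξ η).const_add (f ξ)
    have := (hasDerivAt_comp₂ oG (hasDerivAt_const η (ξ - s)) ((hasDerivAt_id η).add_const s)).mul_const (f s)
    refine this.congr_deriv ?_
    simp only [id]; ring
  -- The endpoint term G_η(0, ξ + η) f(ξ) supplies exactly the contribution of the singular part δ(x
  -- + t) to the potential term.
  have dV : ∀ ξ η, HasDerivAt (fun ξ => V ξ η) (Q ((ξ + η) / 2) / 4 * U ξ η) ξ := by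
    intro ξ η
    have e := hasDerivAt_leibniz (h := fun ξ s => D₂ G (ξ - s) (η + s) * f s)
      (h₁ := fun ξ s => D₁ (D₂ G) (ξ - s) (η + s) * f s) (by fun_prop) (by fun_prop)
      (fun ξ s => ?_) 0 ξ
    · refine e.congr_deriv ?_
      have e2 : ∫ s in (0 : ℝ)..ξ, D₁ (D₂ G) (ξ - s) (η + s) * f s =
          Q ((ξ + η) / 2) / 4 * ∫ s in (0 : ℝ)..ξ, G (ξ - s) (η + s) * f s := by
        rw [← intervalIntegral.integral_const_mul]
        refine intervalIntegral.integral_congr fun s _ => ?_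
        rw [hG.mixed, show ξ - s + (η + s) = ξ + η by ring]; ring
      rw [e2, sub_self, hG.D₂_boundary, hU, add_comm η ξ]; ring
    · have := (hasDerivAt_comp₂ oG2 ((hasDerivAt_id ξ).sub_const s) (hasDerivAt_const ξ (η + s))).mul_const (f s)
      refine this.congr_deriv ?_
      simp only [id]; ring
  have hV' : ∀ ξ η, V ξ η = ∫ s in (0 : ℝ)..ξ, Q ((s + η) / 2) / 4 * U s η := by
    intro ξ η
    rw [intervalIntegral.integral_eq_sub_of_hasDerivAt (f := fun ξ => V ξ η) (fun s _ => dV s η)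
      ((by fun_prop : Continuous _).intervalIntegrable _ _)]
    simp [hV]
  have hfar : ∀ ξ η, 2 * a ≤ η → U ξ η = f ξ := by
    intro ξ η hη
    simp only [hU]
    rw [integral_eq_zero_of_forall_uIcc, add_zero]
    intro s hs
    rcases le_total 0 ξ with h | h
    · rw [uIcc_of_le h] at hs
      rw [hG.eq_zero _ _ (by linarith [hs.2]) (by linarith [hs.1]), zero_mul]
    · rw [uIcc_of_ge h] at hs
      rw [hf0 _ hs.2, mul_zero]
  have hU' : ∀ ξ η, U ξ η = f ξ + 0 + ∫ ξ' in (0 : ℝ)..ξ, ∫ η' in (2 * a)..η, Q ((ξ' + η') / 2) / 4 * U ξ' η' := by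
    intro ξ η
    rw [intervalIntegral_intervalIntegral_swap]
    · have := intervalIntegral.integral_eq_sub_of_hasDerivAt (f := fun η => U ξ η) (a := 2 * a) (b := η)
        (fun s _ => dU ξ s) ((by fun_prop : Continuous _).intervalIntegrable _ _)
      simp only [hV', hfar ξ (2 * a) le_rfl] at this
      rw [this]; ring
    · exact (((hp.continuous.mul hUc).continuousOn (s := uIcc 0 ξ ×ˢ uIcc (2 * a) η)).integrableOn_compact
        (isCompact_uIcc.prod isCompact_uIcc)).mono_set (prod_mono uIoc_subset_uIcc uIoc_subset_uIcc)
  obtain ⟨hU2, -, hm1, hm2⟩ := goursat_regularity (p := fun ξ η => Q ((ξ + η) / 2) / 4) (g₁ := f)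
    (g₂ := fun _ => 0) (b := 2 * a) hp (contDiff_infty.1 hf 2) contDiff_const hUc hU'
  have hdu : ∀ x t, duhamel (fun x t => G (x + t) (x - t)) f x t = U (x + t) (x - t) := by
    intro x t
    have e1 : (Ioi (0 : ℝ)).indicator f (x + t) = f (x + t) := by
      by_cases h : 0 < x + t
      · exact indicator_of_mem (mem_Ioi.2 h) f
      · rw [indicator_of_notMem (by simpa using h), hf0 _ (not_lt.1 h)]
    simp only [duhamel, hU]
    rw [e1]
    congr 1
    rcases le_total 0 (x + t) with h | h
    · rw [intervalIntegral.integral_of_le h]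
      refine integral_congr_ae (ae_of_all _ fun s => ?_)
      simp only
      rw [show x + (t - s) = x + t - s by ring, show x - (t - s) = x - t + s by ring]
    · rw [Ioc_eq_empty (not_lt.2 h), setIntegral_empty, integral_eq_zero_of_forall_uIcc]
      intro s hs
      rw [uIcc_of_ge h] at hs
      rw [hf0 _ hs.2, mul_zero]
  have oU : ContDiff ℝ 1 fun p : ℝ × ℝ => U p.1 p.2 := hU2.of_le (by norm_num)
  have oU1 : ContDiff ℝ 1 fun p : ℝ × ℝ => D₁ U p.1 p.2 := contDiff_D₁ (n := 1) (by exact_mod_cast hU2)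
  have oU2 : ContDiff ℝ 1 fun p : ℝ × ℝ => D₂ U p.1 p.2 := contDiff_D₂ (n := 1) (by exact_mod_cast hU2)
  have hfun : duhamel (fun x t => G (x + t) (x - t)) f = fun x t => U (x + t) (x - t) := by
    ext x t; exact hdu x t
  rw [hfun]
  constructor
  · exact (hU2.comp (f := fun p : ℝ × ℝ => (p.1 + p.2, p.1 - p.2)) (by fun_prop)).contDiffOn
  · intro x t hx _
    have t1 : deriv (fun t' => U (x + t') (x - t')) = fun t => D₁ U (x + t) (x - t) - D₂ U (x + t) (x - t) := by
      ext t
      refine (hasDerivAt_comp₂ oU ((hasDerivAt_id t).const_add x) ((hasDerivAt_id t).const_sub x)).deriv.trans ?_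
      simp only [id]; ring
    have x1 : deriv (fun x' => U (x' + t) (x' - t)) = fun x => D₁ U (x + t) (x - t) + D₂ U (x + t) (x - t) := by
      ext x
      refine (hasDerivAt_comp₂ oU ((hasDerivAt_id x).add_const t) ((hasDerivAt_id x).sub_const t)).deriv.trans ?_
      simp only [id]; ring
    have t2 := ((hasDerivAt_comp₂ oU1 ((hasDerivAt_id t).const_add x) ((hasDerivAt_id t).const_sub x)).sub
      (hasDerivAt_comp₂ oU2 ((hasDerivAt_id t).const_add x) ((hasDerivAt_id t).const_sub x))).deriv
    have x2 := ((hasDerivAt_comp₂ oU1 ((hasDerivAt_id x).add_const t) ((hasDerivAt_id x).sub_const t)).add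
      (hasDerivAt_comp₂ oU2 ((hasDerivAt_id x).add_const t) ((hasDerivAt_id x).sub_const t))).deriv
    have t2' : deriv (fun t => D₁ U (x + t) (x - t) - D₂ U (x + t) (x - t)) t = _ := t2
    have x2' : deriv (fun x => D₁ U (x + t) (x - t) + D₂ U (x + t) (x - t)) x = _ := x2
    rw [t1, x1, t2', x2']
    simp only [id]
    rw [hm1, hm2, show (x + t + (x - t)) / 2 = x by ring, hQq x hx.le]
    ring
  · intro x t _ ht
    rw [← hdu]
    simp only [duhamel]
    rw [indicator_of_notMem (by simp only [mem_Ioi]; linarith), Ioc_eq_empty (by linarith)]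
    simp
  · intro τ _
    refine tendsto_const_nhds.congr' ?_
    filter_upwards [eventually_ge_atTop ((τ + 2 * a) / 2)] with s hs
    rw [hfar _ _ (by linarith), add_sub_cancel]

theorem IsGoursatKernel.isFundamentalKernel {Q q : ℝ → ℝ} {a : ℝ} {G : ℝ → ℝ → ℝ}
    (hG : IsGoursatKernel Q a G) (hQ : ContDiff ℝ 1 Q) (hQq : ∀ x, 0 ≤ x → Q x = q x) :
    IsFundamentalKernel q fun x t => G (x + t) (x - t) := by
  have cG := hG.contDiff.continuous
  refine ⟨by fun_prop, fun f hf ⟨ε, hε, h0⟩ => ?_⟩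
  exact hG.isClassicalWave hQ hQq hf fun τ hτ => h0 τ (by linarith)

/-! ### Uniqueness of the classical solution and of the fundamental solution -/

theorem hasDerivAt_fderiv_comp {u : ℝ × ℝ → ℝ} {c : ℝ → ℝ × ℝ} {v : ℝ × ℝ} {t : ℝ}
    (hc : HasDerivAt c v t) (hu : ContDiffAt ℝ 2 u (c t)) (w : ℝ × ℝ) :
    HasDerivAt (fun s => fderiv ℝ u (c s) w) (fderiv ℝ (fderiv ℝ u) (c t) v w) t := by
  have h2 : HasFDerivAt (fderiv ℝ u) (fderiv ℝ (fderiv ℝ u) (c t)) (c t) :=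
    ((hu.fderiv_right (m := 1) (by norm_num)).differentiableAt one_ne_zero).hasFDerivAt
  have h3 := (h2.comp_hasDerivAt t hc).clm_apply (hasDerivAt_const t w)
  simp only [Function.comp_apply, map_zero, add_zero] at h3
  exact h3

theorem deriv_deriv_comp_affine {u : ℝ × ℝ → ℝ} {c : ℝ → ℝ × ℝ} {v : ℝ × ℝ} {t : ℝ}
    (hc : ∀ s, HasDerivAt c v s) (hu : ContDiffAt ℝ 2 u (c t)) :
    deriv (deriv fun s => u (c s)) t = fderiv ℝ (fderiv ℝ u) (c t) v v := by
  have h1 : (deriv fun s => u (c s)) =ᶠ[𝓝 t] fun s => fderiv ℝ u (c s) v := by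
    have := (hc t).continuousAt.eventually (hu.eventually (by simp))
    filter_upwards [this] with s hs
    exact ((hs.differentiableAt two_ne_zero).hasFDerivAt.comp_hasDerivAt s (hc s)).deriv
  rw [h1.deriv_eq]
  exact (hasDerivAt_fderiv_comp (hc t) hu v).deriv

/-- A classical solution in characteristic coordinates. -/
theorem IsClassicalWave.hasDerivAt_characteristic {Q q f : ℝ → ℝ} {u : ℝ → ℝ → ℝ}
    (hu : IsClassicalWave q f u) (hQ : Continuous Q) (hQq : ∀ x, 0 ≤ x → Q x = q x)
    {ξ η : ℝ} (hξ : 0 ≤ ξ) (hη : 0 < η) :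
    HasDerivAt (fun η => u ((ξ + η) / 2) ((ξ - η) / 2))
      (∫ s in (0 : ℝ)..ξ, Q ((s + η) / 2) / 4 * u ((s + η) / 2) ((s - η) / 2)) η := by
  set v : ℝ × ℝ → ℝ := fun p => u p.1 p.2 with hv
  have hopen : IsOpen {p : ℝ × ℝ | 0 < p.1 ∧ p.2 < p.1} :=
    (isOpen_lt continuous_const continuous_fst).inter (isOpen_lt continuous_snd continuous_fst)
  have hat : ∀ ξ η, 0 ≤ ξ → 0 < η → ContDiffAt ℝ 2 v ((ξ + η) / 2, (ξ - η) / 2) := fun ξ η h1 h2 =>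
    hu.contDiffOn.contDiffAt (hopen.mem_nhds ⟨by simp only; linarith, by simp only; linarith⟩)
  have lη : ∀ ξ η : ℝ, HasDerivAt (fun η : ℝ => ((ξ + η) / 2, (ξ - η) / 2)) ((1 / 2 : ℝ), (-1 / 2 : ℝ)) η :=
    fun ξ η => (((hasDerivAt_id η).const_add ξ).div_const 2).prodMk (((hasDerivAt_id η).const_sub ξ).div_const 2)
  have lξ : ∀ ξ η : ℝ, HasDerivAt (fun ξ : ℝ => ((ξ + η) / 2, (ξ - η) / 2)) ((1 / 2 : ℝ), (1 / 2 : ℝ)) ξ :=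
    fun ξ η => (((hasDerivAt_id ξ).add_const η).div_const 2).prodMk (((hasDerivAt_id ξ).sub_const η).div_const 2)
  set V : ℝ → ℝ → ℝ := fun ξ η => fderiv ℝ v ((ξ + η) / 2, (ξ - η) / 2) (1 / 2, -1 / 2) with hV
  have dU : ∀ ξ η, 0 ≤ ξ → 0 < η → HasDerivAt (fun η => u ((ξ + η) / 2) ((ξ - η) / 2)) (V ξ η) η :=
    fun ξ η h1 h2 => by
      have h := ((hat ξ η h1 h2).differentiableAt two_ne_zero).hasFDerivAt.comp_hasDerivAt η (lη ξ η)
      exact h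
  have dV : ∀ ξ, 0 ≤ ξ → HasDerivAt (fun ξ => V ξ η)
      (Q ((ξ + η) / 2) / 4 * u ((ξ + η) / 2) ((ξ - η) / 2)) ξ := by
    intro ξ h1
    have h2 := hat ξ η h1 hη
    have e2 := hasDerivAt_fderiv_comp (lξ ξ η) h2 ((1 / 2 : ℝ), (-1 / 2 : ℝ))
    refine e2.congr_deriv ?_
    have w := hu.wave_eq ((ξ + η) / 2) ((ξ - η) / 2) (by linarith) (by linarith)
    have wt := deriv_deriv_comp_affine (u := v) (c := fun t => ((ξ + η) / 2, t)) (v := (0, 1)) (t := (ξ - η) / 2)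
      (fun s => (hasDerivAt_const s _).prodMk (hasDerivAt_id s)) h2
    have wx := deriv_deriv_comp_affine (u := v) (c := fun x => (x, (ξ - η) / 2)) (v := (1, 0)) (t := (ξ + η) / 2)
      (fun s => (hasDerivAt_id s).prodMk (hasDerivAt_const s _)) h2
    have hsym := (h2.isSymmSndFDerivAt (by simp)) (1, 0) (0, 1)
    simp only [hv] at wt wx hsym ⊢
    rw [wt, wx, ← hQq _ (by linarith)] at w
    set L := fderiv ℝ (fderiv ℝ fun p : ℝ × ℝ => u p.1 p.2) ((ξ + η) / 2, (ξ - η) / 2) with hL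
    have d1 : ((1 / 2 : ℝ), (1 / 2 : ℝ)) = (1 / 2 : ℝ) • ((1 : ℝ), (0 : ℝ)) + (1 / 2 : ℝ) • ((0 : ℝ), (1 : ℝ)) := by
      ext <;> simp
    have d2 : ((1 / 2 : ℝ), (-1 / 2 : ℝ)) = (1 / 2 : ℝ) • ((1 : ℝ), (0 : ℝ)) + (-1 / 2 : ℝ) • ((0 : ℝ), (1 : ℝ)) := by
      ext <;> simp
    rw [d1, d2]
    simp only [map_add, map_smul, add_apply, smul_apply, smul_eq_mul]
    rw [hsym]
    linarith
  -- Vanishing for t < -x passes by continuity to the characteristic ξ = 0, so the integration of V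
  -- in ξ starts from zero.
  have hzero : ∀ η, 0 < η → u ((0 + η) / 2) ((0 - η) / 2) = 0 := by
    intro η hη
    have hc : ContinuousAt (fun ξ => u ((ξ + η) / 2) ((ξ - η) / 2)) 0 :=
      (hat 0 η le_rfl hη).continuousAt.comp (f := fun ξ : ℝ => ((ξ + η) / 2, (ξ - η) / 2)) (lξ 0 η).continuousAt
    have h1 : Tendsto (fun ξ => u ((ξ + η) / 2) ((ξ - η) / 2)) (𝓝[<] 0) (𝓝 0) := by
      refine tendsto_const_nhds.congr' ?_
      filter_upwards [self_mem_nhdsWithin, mem_nhdsWithin_of_mem_nhds (Ioi_mem_nhds (show -η < 0 by linarith))]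
        with ξ h1 h2
      simp only [mem_Iio, mem_Ioi] at h1 h2
      exact (hu.eq_zero _ _ (by linarith) (by linarith)).symm
    exact tendsto_nhds_unique (hc.tendsto.mono_left nhdsWithin_le_nhds) h1
  have hV0 : V 0 η = 0 := by
    refine (dU 0 η le_rfl hη).unique ((hasDerivAt_const η (0 : ℝ)).congr_of_eventuallyEq ?_)
    filter_upwards [Ioi_mem_nhds hη] with z hz
    exact hzero z hz
  have := intervalIntegral.integral_eq_sub_of_hasDerivAt (f := fun ξ => V ξ η) (a := 0) (b := ξ)
    (fun s hs => by rw [uIcc_of_le hξ] at hs; exact dV s hs.1) (by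
      refine ContinuousOn.intervalIntegrable fun s hs => ?_
      rw [uIcc_of_le hξ] at hs
      refine ContinuousAt.continuousWithinAt ?_
      have h1 : ContinuousAt (fun ξ => u ((ξ + η) / 2) ((ξ - η) / 2)) s :=
        (hat s η hs.1 hη).continuousAt.comp (f := fun ξ : ℝ => ((ξ + η) / 2, (ξ - η) / 2)) (lξ s η).continuousAt
      exact (by fun_prop : Continuous fun s => Q ((s + η) / 2) / 4).continuousAt.mul h1)
  rw [this, hV0, sub_zero]
  exact dU ξ η hξ hη

theorem IsClassicalWave.continuousOn_characteristic {q f : ℝ → ℝ} {u : ℝ → ℝ → ℝ}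
    (hu : IsClassicalWave q f u) :
    ContinuousOn (fun p : ℝ × ℝ => u ((p.1 + p.2) / 2) ((p.1 - p.2) / 2)) {p | 0 ≤ p.1 ∧ 0 < p.2} := by
  refine hu.contDiffOn.continuousOn.comp (f := fun p : ℝ × ℝ => ((p.1 + p.2) / 2, (p.1 - p.2) / 2))
    (by fun_prop) fun p hp => ?_
  obtain ⟨h1, h2⟩ := hp
  exact ⟨by simp only; linarith, by simp only; linarith⟩

/-- The difference d satisfies d_η = ∫_0^ξ (Q/4) d. Far out this makes d constant in η, and the
common incident profile makes the constant zero. Integrating back in η yields a Volterra gain in ξ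
on a compact rectangle. -/
theorem IsClassicalWave.unique {Q q f : ℝ → ℝ} {a : ℝ} {u₁ u₂ : ℝ → ℝ → ℝ}
    (hu₁ : IsClassicalWave q f u₁) (hu₂ : IsClassicalWave q f u₂) (hQ : Continuous Q)
    (hQq : ∀ x, 0 ≤ x → Q x = q x) (ha : 0 ≤ a) (hQa : ∀ x, a ≤ x → Q x = 0)
    {x t : ℝ} (htx : -x ≤ t) (ht : t < x) : u₁ x t = u₂ x t := by
  set d : ℝ → ℝ → ℝ := fun ξ η =>
    u₁ ((ξ + η) / 2) ((ξ - η) / 2) - u₂ ((ξ + η) / 2) ((ξ - η) / 2) with hd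
  have hdc : ContinuousOn (fun p : ℝ × ℝ => d p.1 p.2) {p | 0 ≤ p.1 ∧ 0 < p.2} :=
    hu₁.continuousOn_characteristic.sub hu₂.continuousOn_characteristic
  have hline : ∀ {u : ℝ → ℝ → ℝ}, IsClassicalWave q f u → ∀ {ξ η : ℝ}, 0 ≤ ξ → 0 < η →
      IntervalIntegrable (fun s => Q ((s + η) / 2) / 4 * u ((s + η) / 2) ((s - η) / 2)) volume 0 ξ := by
    intro u hu ξ η hξ hη
    refine ContinuousOn.intervalIntegrable ?_
    rw [uIcc_of_le hξ]
    refine (by fun_prop : Continuous fun s => Q ((s + η) / 2) / 4).continuousOn.mul ?_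
    exact hu.continuousOn_characteristic.comp (f := fun s : ℝ => (s, η)) (by fun_prop) fun s hs => ⟨hs.1, hη⟩
  have hder : ∀ ξ η, 0 ≤ ξ → 0 < η →
      HasDerivAt (fun η => d ξ η) (∫ s in (0 : ℝ)..ξ, Q ((s + η) / 2) / 4 * d s η) η := by
    intro ξ η hξ hη
    refine ((hu₁.hasDerivAt_characteristic hQ hQq hξ hη).sub
      (hu₂.hasDerivAt_characteristic hQ hQq hξ hη)).congr_deriv ?_
    rw [← intervalIntegral.integral_sub (hline hu₁ hξ hη) (hline hu₂ hξ hη)]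
    refine intervalIntegral.integral_congr fun s _ => ?_
    simp only [hd]; ring
  -- The added 1 keeps η positive when a = 0, where the equation for d is available.
  have hfar : ∀ ξ η, 0 ≤ ξ → 2 * a + 1 ≤ η → d ξ η = 0 := by
    intro ξ η hξ hη
    have hconst : ∀ η' ≥ η, d ξ η' = d ξ η := fun η' hη' => by
      refine constant_of_has_deriv_right_zero (f := fun η => d ξ η) (a := η) (b := η')
        (fun z hz => (hder ξ z hξ (by linarith [hz.1])).continuousAt.continuousWithinAt) (fun z hz => ?_) η'
        ⟨hη', le_rfl⟩
      have := hder ξ z hξ (by linarith [hz.1])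
      rw [integral_eq_zero_of_forall_uIcc] at this
      · exact this.hasDerivWithinAt
      · intro s hs
        rw [uIcc_of_le hξ] at hs
        rw [hQa _ (by linarith [hs.1, hz.1])]; ring
    have h1 := (hu₁.incident ξ hξ).sub (hu₂.incident ξ hξ)
    rw [sub_self] at h1
    refine tendsto_nhds_unique (tendsto_const_nhds.congr' ?_) h1
    filter_upwards [eventually_ge_atTop ((ξ + η) / 2)] with s hs
    rw [← hconst (2 * s - ξ) (by linarith)]
    simp only [hd]
    rw [show (ξ + (2 * s - ξ)) / 2 = s by ring, show (ξ - (2 * s - ξ)) / 2 = ξ - s by ring]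
  suffices h : d (x + t) (x - t) = 0 by
    simp only [hd] at h
    rw [show (x + t + (x - t)) / 2 = x by ring, show (x + t - (x - t)) / 2 = t by ring] at h
    linarith
  set R := x + t
  set δ := x - t with hδ
  have hδ0 : 0 < δ := by linarith
  have hR : 0 ≤ R := by simp only [R]; linarith
  set B := max δ (2 * a + 1)
  have hsub : Icc 0 R ×ˢ Icc δ B ⊆ {p : ℝ × ℝ | 0 ≤ p.1 ∧ 0 < p.2} := fun p hp =>
    ⟨hp.1.1, lt_of_lt_of_le hδ0 hp.2.1⟩
  obtain ⟨C, hC⟩ := (isCompact_Icc.prod isCompact_Icc).exists_bound_of_continuousOn (hdc.mono hsub)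
  obtain ⟨K, hK⟩ := (isCompact_Icc (a := (0 : ℝ)) (b := (R + B) / 2)).exists_bound_of_continuousOn
    (hQ.div_const 4).continuousOn
  refine eq_zero_of_volterra_gain (S := Icc 0 R ×ˢ Icc δ B) (ℓ := Prod.fst) (u := fun p : ℝ × ℝ => d p.1 p.2)
    (C := C) (M := |K| * B) hC (fun n c hc p hp => ?_) (x := (R, δ))
    ⟨⟨hR, le_rfl⟩, ⟨le_rfl, le_max_left _ _⟩⟩
  obtain ⟨⟨hp1, hp1'⟩, hp2, hp2'⟩ := hp
  have hgain : ∀ η ∈ Icc p.2 B, ‖∫ s in (0 : ℝ)..p.1, Q ((s + η) / 2) / 4 * d s η‖ ≤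
      |K| * c * |p.1| ^ (n + 1) / (n + 1) := by
    intro η hη
    refine abs_integral_le_pow fun s hs => ?_
    rw [uIcc_of_le hp1] at hs
    rw [abs_mul, mul_assoc]
    refine mul_le_mul ((hK _ ⟨?_, ?_⟩).trans (le_abs_self K))
      (hc (s, η) ⟨⟨hs.1, hs.2.trans hp1'⟩, hp2.trans hη.1, hη.2⟩) (abs_nonneg _) (abs_nonneg _)
    · linarith [hs.1, hη.1]
    · linarith [hs.2, hη.2]
  have hmv := Convex.norm_image_sub_le_of_norm_hasDerivWithin_le (f := fun η => d p.1 η)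
    (fun η hη => (hder p.1 η hp1 (by linarith [hη.1])).hasDerivWithinAt) hgain (convex_Icc p.2 B)
    ⟨hp2', le_rfl⟩ ⟨le_rfl, hp2'⟩
  rw [hfar _ B hp1 (le_max_right _ _), sub_zero] at hmv
  refine hmv.trans ?_
  have h0 : 0 ≤ |K| * c * |p.1| ^ (n + 1) / (n + 1) := (norm_nonneg _).trans (hgain B ⟨hp2', le_rfl⟩)
  have h1 : ‖p.2 - B‖ ≤ B := by
    rw [Real.norm_eq_abs, abs_sub_comm, abs_of_nonneg (by linarith)]; linarith
  calc _ ≤ |K| * c * |p.1| ^ (n + 1) / (n + 1) * B := by gcongr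
    _ = _ := by ring

/-- By uniqueness of classical solutions the two kernels have equal integrals against every test
control. The fundamental lemma of the calculus of variations gives equality almost everywhere on a
time slice, and continuity does the rest. -/
theorem IsFundamentalKernel.eq_on_wedge {Q q : ℝ → ℝ} {a : ℝ} {w₁ w₂ : ℝ → ℝ → ℝ}
    (h₁ : IsFundamentalKernel q w₁) (h₂ : IsFundamentalKernel q w₂) (hQ : Continuous Q)
    (hQq : ∀ x, 0 ≤ x → Q x = q x) (ha : 0 ≤ a) (hQa : ∀ x, a ≤ x → Q x = 0)
    {x t : ℝ} (hxt : -x ≤ t) (htx : t ≤ x) : w₁ x t = w₂ x t := by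
  have hslice : ∀ {w : ℝ → ℝ → ℝ}, IsFundamentalKernel q w → ∀ {x t : ℝ}, 0 < x → t < x →
      ContinuousOn (fun s => w x (t - s)) (Icc 0 (x + t)) := fun hw x t hx ht =>
    hw.continuousOn.comp (f := fun s : ℝ => (x, t - s)) (by fun_prop) fun s hs =>
      ⟨hx.le, by simp only; linarith [hs.2], by simp only; linarith [hs.1]⟩
  have hin : ∀ x t : ℝ, -x < t → t < x → w₁ x t = w₂ x t := by
    intro x t' h1 h2
    have hx : 0 < x := by linarith
    -- A time strictly between t' and x, so that t' = t - s with s interior to the interval of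
    -- integration.
    set t := (t' + x) / 2 with ht
    have htx : t < x := by linarith
    have c₁ := hslice h₁ hx htx
    have c₂ := hslice h₂ hx htx
    have hae := isOpen_Ioo.ae_eq_zero_of_integral_contDiff_smul_eq_zero (U := Ioo 0 (x + t)) (μ := volume)
      (f := fun s => w₁ x (t - s) - w₂ x (t - s))
      (((c₁.sub c₂).mono Ioo_subset_Icc_self).locallyIntegrableOn measurableSet_Ioo) (fun g hg hgc hgs => by
        have hε : ∃ ε > 0, ∀ τ < ε, g τ = 0 := by
          rcases (tsupport g).eq_empty_or_nonempty with h | h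
          · exact ⟨1, one_pos, fun τ _ => image_eq_zero_of_notMem_tsupport (by simp [h])⟩
          · obtain ⟨m, hm, hmin⟩ := hgc.isCompact.exists_isLeast h
            exact ⟨m, (hgs hm).1, fun τ hτ => image_eq_zero_of_notMem_tsupport fun hτ' =>
              absurd (hmin hτ') (not_le.2 hτ)⟩
        have e := (h₁.isClassicalWave g hg hε).unique (h₂.isClassicalWave g hg hε) hQ hQq ha hQa
          (x := x) (t := t) (by linarith) htx
        simp only [duhamel] at e
        have i₁ : IntegrableOn (fun s => w₁ x (t - s) * g s) (Ioc 0 (x + t)) :=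
          ((c₁.mul hg.continuous.continuousOn).integrableOn_Icc).mono_set Ioc_subset_Icc_self
        have i₂ : IntegrableOn (fun s => w₂ x (t - s) * g s) (Ioc 0 (x + t)) :=
          ((c₂.mul hg.continuous.continuousOn).integrableOn_Icc).mono_set Ioc_subset_Icc_self
        have e2 : ∫ s in Ioc 0 (x + t), (w₁ x (t - s) * g s - w₂ x (t - s) * g s) = 0 := by
          rw [integral_sub i₁ i₂]; linarith
        rw [← e2, ← integral_indicator measurableSet_Ioc]
        refine integral_congr_ae (ae_of_all _ fun s => ?_)
        simp only [smul_eq_mul]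
        by_cases hs : s ∈ Ioc 0 (x + t)
        · rw [indicator_of_mem hs]; ring
        · rw [indicator_of_notMem hs, image_eq_zero_of_notMem_tsupport (fun h => hs (Ioo_subset_Ioc_self (hgs h))),
            zero_mul])
    have heq := Measure.eqOn_open_of_ae_eq (μ := volume) (U := Ioo 0 (x + t))
      (f := fun s => w₁ x (t - s)) (g := fun s => w₂ x (t - s))
      ((ae_restrict_iff' measurableSet_Ioo).2 (hae.mono fun s hs hs' => sub_eq_zero.1 (hs hs'))) isOpen_Ioo
      (c₁.mono Ioo_subset_Icc_self) (c₂.mono Ioo_subset_Icc_self)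
    have := heq (show t - t' ∈ Ioo 0 (x + t) from ⟨by linarith, by linarith⟩)
    simpa using this
  have hx : 0 ≤ x := by linarith
  -- The edges of the wedge are reached from its interior by letting x decrease at fixed t.
  have hlim : ∀ {w : ℝ → ℝ → ℝ}, IsFundamentalKernel q w →
      Tendsto (fun z => w z t) (𝓝[>] x) (𝓝 (w x t)) := by
    intro w hw
    refine (hw.continuousOn (x, t) ⟨hx, hxt, htx⟩).tendsto.comp
      (tendsto_nhdsWithin_iff.2 ⟨?_, ?_⟩ : Tendsto (fun z : ℝ => (z, t)) _ _)
    · exact ((by fun_prop : Continuous fun z : ℝ => (z, t)).tendsto x).mono_left nhdsWithin_le_nhds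
    · filter_upwards [self_mem_nhdsWithin] with z hz
      have hz : x < z := hz
      exact ⟨by linarith, by linarith, by linarith⟩
  refine tendsto_nhds_unique (hlim h₁) ((hlim h₂).congr' ?_)
  filter_upwards [self_mem_nhdsWithin] with z hz
  have hz : x < z := hz
  exact (hin z t (by linarith) (by linarith)).symm

/-! ### Integral identities for the control kernel and its resolvent -/

/-- `L` is the resolvent kernel of the Volterra kernel `K`. -/
def IsResolvent (K L : ℝ → ℝ → ℝ) : Prop :=
  ∀ x s, K x s + L x s + ∫ σ in s..x, K x σ * L σ s = 0

theorem exists_isResolvent {K : ℝ → ℝ → ℝ} (hK : Continuous fun p : ℝ × ℝ => K p.1 p.2) :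
    ∃ L : ℝ → ℝ → ℝ, Continuous (fun p : ℝ × ℝ => L p.1 p.2) ∧ IsResolvent K L := by
  obtain ⟨L, hL, h⟩ := exists_resolvent_kernel (N := fun x s => -K x s) hK.neg
  refine ⟨L, hL, fun x s => ?_⟩
  have := h x s
  simp only [neg_mul, intervalIntegral.integral_neg] at this
  linarith

namespace IsResolvent
variable {K L : ℝ → ℝ → ℝ}

/-- The resolvent identity at x involves K only with first argument x. -/
theorem eq_zero (h : IsResolvent K L) {B : ℝ}
    (hKB : ∀ x s, B ≤ x → 0 ≤ s → s ≤ x → K x s = 0) (x s : ℝ) (hx : B ≤ x) (hs : 0 ≤ s) (hsx : s ≤ x) :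
    L x s = 0 := by
  have := h x s
  rw [integral_eq_zero_of_forall_uIcc, hKB x s hx hs hsx] at this
  · linarith
  · intro σ hσ
    rw [uIcc_of_le hsx] at hσ
    rw [hKB x σ hx (hs.trans hσ.1) hσ.2, zero_mul]

theorem intervalIntegrable_volterra (hL : Continuous fun p : ℝ × ℝ => L p.1 p.2) {h : ℝ → ℝ} {c x : ℝ} (hcx : c ≤ x)
    (hh : IntervalIntegrable h volume c x) :
    IntervalIntegrable (fun s => ∫ σ in c..s, L s σ * h σ) volume c x := by
  obtain ⟨C, hC⟩ := (isCompact_Icc.prod isCompact_Icc).exists_bound_of_continuousOn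
    (hL.continuousOn (s := Icc c x ×ˢ Icc c x))
  have hh' := (intervalIntegrable_iff_integrableOn_Ioc_of_le hcx).1 hh
  rw [intervalIntegrable_iff_integrableOn_Ioc_of_le hcx]
  have hT : MeasurableSet {p : ℝ × ℝ | p.2 ≤ p.1} := measurableSet_le measurable_snd measurable_fst
  have hm : AEStronglyMeasurable (fun s => ∫ σ in Ioc c x, ({p : ℝ × ℝ | p.2 ≤ p.1}.indicator
      (fun p => L p.1 p.2 * h p.2)) (s, σ)) (volume.restrict (Ioc c x)) :=
    ((hL.aestronglyMeasurable.mul hh'.aestronglyMeasurable.comp_snd).indicator hT).integral_prod_right'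
  refine Integrable.mono' (g := fun _ => |C| * ∫ σ in Ioc c x, |h σ|)
    (integrableOn_const (by simp)) (hm.congr ?_) ?_
  · refine (ae_restrict_iff' measurableSet_Ioc).2 (ae_of_all _ fun s hs => ?_)
    simp only
    rw [intervalIntegral.integral_of_le hs.1.le, ← integral_indicator measurableSet_Ioc,
      ← integral_indicator measurableSet_Ioc]
    congr 1
    ext σ
    simp only [indicator, mem_Ioc, mem_ofPred_eq]
    split_ifs <;> first | rfl | (exfalso; grind)
  · refine (ae_restrict_iff' measurableSet_Ioc).2 (ae_of_all _ fun s hs => ?_)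
    rw [intervalIntegral.integral_of_le hs.1.le, ← integral_const_mul]
    refine (norm_integral_le_of_norm_le (g := fun σ => |C| * |h σ|)
      ((hh'.mono_set (Ioc_subset_Ioc_right hs.2)).abs.const_mul _) ?_).trans ?_
    · refine (ae_restrict_iff' measurableSet_Ioc).2 (ae_of_all _ fun σ hσ => ?_)
      rw [norm_mul]
      exact mul_le_mul_of_nonneg_right ((hC (s, σ) ⟨⟨hs.1.le, hs.2⟩, hσ.1.le, hσ.2.trans hs.2⟩).trans (le_abs_self C))
        (norm_nonneg _)
    · exact setIntegral_mono_set (hh'.abs.const_mul _) (ae_of_all _ fun σ => by positivity)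
        (Ioc_subset_Ioc_right hs.2).eventuallyLE

/-- The operator with the resolvent kernel is a right inverse. -/
theorem right_inverse (hr : IsResolvent K L) (hK : Continuous fun p : ℝ × ℝ => K p.1 p.2)
    (hL : Continuous fun p : ℝ × ℝ => L p.1 p.2) {h : ℝ → ℝ} {c x : ℝ} (hcx : c ≤ x)
    (hh : IntervalIntegrable h volume c x) :
    ∫ s in c..x, K x s * (h s + ∫ σ in c..s, L s σ * h σ) = -∫ s in c..x, L x s * h s := by
  have cK : Continuous fun s => K x s := by fun_prop
  have i1 : IntervalIntegrable (fun s => K x s * h s) volume c x := hh.continuousOn_mul cK.continuousOn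
  have i2 : IntervalIntegrable (fun s => K x s * ∫ σ in c..s, L s σ * h σ) volume c x :=
    (intervalIntegrable_volterra hL hcx hh).continuousOn_mul cK.continuousOn
  simp only [mul_add]
  rw [intervalIntegral.integral_add i1 i2, integral_triangle_swap hL hcx (cK.intervalIntegrable _ _) hh,
    ← intervalIntegral.integral_neg, ← intervalIntegral.integral_add i1]
  · refine intervalIntegral.integral_congr fun s _ => ?_
    rw [show ∫ σ in s..x, K x σ * L σ s = -K x s - L x s by linarith [hr x s]]
    ring
  · have c3 : Continuous fun s => -K x s - L x s := by fun_prop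
    refine (hh.continuousOn_mul c3.continuousOn).congr fun s _ => ?_
    rw [show ∫ σ in s..x, K x σ * L σ s = -K x s - L x s by linarith [hr x s]]

/-- The product (1 + Lᵗ)(1 + Kᵗ) is the transpose of (1 + K)(1 + L) = 1, so the same resolvent
identity serves after a change of order of integration. -/
theorem transpose_left_inverse (hr : IsResolvent K L) (hK : Continuous fun p : ℝ × ℝ => K p.1 p.2)
    (hL : Continuous fun p : ℝ × ℝ => L p.1 p.2) {y E : ℝ → ℝ} {τ B : ℝ} (hτB : τ ≤ B)
    (hE : Continuous E) (hy : IntervalIntegrable y volume τ B)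
    (h : ∀ s ∈ Icc τ B, y s + ∫ x in s..B, K x s * y x = E s) :
    E τ + ∫ s in τ..B, L s τ * E s = y τ := by
  have cL : Continuous fun s => L s τ := by fun_prop
  have cK : Continuous fun x => K x τ := by fun_prop
  have e1 : ∫ s in τ..B, L s τ * E s =
      (∫ s in τ..B, L s τ * y s) + ∫ s in τ..B, (∫ x in s..B, y x * K x s) * L s τ := by
    have i1 : IntervalIntegrable (fun s => L s τ * y s) volume τ B := hy.continuousOn_mul cL.continuousOn
    have hfun : ∀ s ∈ uIcc τ B, (∫ x in s..B, y x * K x s) * L s τ = L s τ * E s - L s τ * y s := by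
      intro s hs
      rw [uIcc_of_le hτB] at hs
      rw [← h s hs]
      simp only [mul_comm (y _)]
      ring
    rw [← intervalIntegral.integral_add i1]
    · refine intervalIntegral.integral_congr fun s hs => ?_
      rw [hfun s hs]; ring
    · refine ((((cL.mul hE).intervalIntegrable τ B).sub i1)).congr fun s hs => ?_
      exact (hfun s (uIoc_subset_uIcc hs)).symm
  rw [e1, ← integral_triangle_swap hK hτB hy (cL.intervalIntegrable _ _),
    ← intervalIntegral.integral_add (hy.continuousOn_mul cL.continuousOn)]
  · have e2 : ∫ x in τ..B, (L x τ * y x + y x * ∫ s in τ..x, K x s * L s τ) = -∫ x in τ..B, K x τ * y x := by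
      rw [← intervalIntegral.integral_neg]
      refine intervalIntegral.integral_congr fun x _ => ?_
      rw [show ∫ σ in τ..x, K x σ * L σ τ = -K x τ - L x τ by linarith [hr x τ]]
      ring
    rw [e2, ← h τ ⟨le_rfl, hτB⟩]
    ring
  · have c3 : Continuous fun x => -K x τ - L x τ := by fun_prop
    refine (hy.mul_continuousOn c3.continuousOn).congr fun x _ => ?_
    rw [show ∫ σ in τ..x, K x σ * L σ τ = -K x τ - L x τ by linarith [hr x τ]]

end IsResolvent

/-- The transpose of the control operator composed with the control operator is the identity plus a
Hankel operator. -/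
theorem IsGoursatKernel.hankel_apply {Q : ℝ → ℝ} {a : ℝ} {G : ℝ → ℝ → ℝ} (hG : IsGoursatKernel Q a G)
    (ha : 0 ≤ a) {g h : ℝ → ℝ} (hg : Continuous g) {ξ τ B : ℝ} (hξ : 0 ≤ ξ) (hξτ : ξ ≤ τ) (hτ : 0 < τ)
    (hB : 2 * a ≤ B) (hτB : τ ≤ B)
    (hh : ∀ x, ξ ≤ x → h x = g x + ∫ s in ξ..x, G (x - s) (x + s) * g s) :
    g τ + ∫ s in ξ..B, G (2 * a) (τ + s) * g s = h τ + ∫ x in τ..B, G (x - τ) (x + τ) * h x := by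
  have cG := hG.contDiff.continuous
  have cK : Continuous fun p : ℝ × ℝ => G (p.1 - p.2) (p.1 + p.2) := by fun_prop
  have ci : ∀ c : ℝ, Continuous fun x => ∫ s in c..x, G (x - s) (x + s) * g s := fun c =>
    intervalIntegral.continuous_parametric_intervalIntegral_of_continuous
      (f := fun x s => G (x - s) (x + s) * g s) (by fun_prop) continuous_id
  have cj : Continuous fun x => ∫ s in ξ..τ, G (x - s) (x + s) * g s :=
    intervalIntegral.continuous_parametric_intervalIntegral_of_continuous
      (f := fun x s => G (x - s) (x + s) * g s) (by fun_prop) continuous_const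
  -- The inner integral is split at s = τ: `hankel` wants its smaller argument first, so for s > τ
  -- it is applied with s and τ exchanged.
  have e1 : ∫ x in τ..B, G (x - τ) (x + τ) * h x = (∫ x in τ..B, G (x - τ) (x + τ) * g x)
      + ((∫ x in τ..B, ∫ s in ξ..τ, G (x - τ) (x + τ) * (G (x - s) (x + s) * g s))
        + ∫ x in τ..B, G (x - τ) (x + τ) * ∫ s in τ..x, G (x - s) (x + s) * g s) := by
    simp only [intervalIntegral.integral_const_mul]
    rw [← intervalIntegral.integral_add, ← intervalIntegral.integral_add]
    · refine intervalIntegral.integral_congr fun x hx => ?_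
      rw [uIcc_of_le hτB] at hx
      have cx : Continuous fun s => G (x - s) (x + s) * g s := by fun_prop
      rw [hh x (hξτ.trans hx.1), ← intervalIntegral.integral_add_adjacent_intervals
        (cx.intervalIntegrable ξ τ) (cx.intervalIntegrable τ x)]
      ring
    · exact (by fun_prop : Continuous _).intervalIntegrable _ _
    · have := ci τ
      exact (by fun_prop : Continuous _).intervalIntegrable _ _
    · exact (by fun_prop : Continuous _).intervalIntegrable _ _
    · have := ci τ
      have := cj
      exact (by fun_prop : Continuous _).intervalIntegrable _ _
  have e2 : ∫ x in τ..B, ∫ s in ξ..τ, G (x - τ) (x + τ) * (G (x - s) (x + s) * g s) =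
      ∫ s in ξ..τ, (G (2 * a) (τ + s) * g s - G (τ - s) (τ + s) * g s) := by
    rw [intervalIntegral_intervalIntegral_swap]
    · refine intervalIntegral.integral_congr fun s hs => ?_
      rw [uIcc_of_le hξτ] at hs
      rw [← hG.hankel ha (hξ.trans hs.1) hs.2 hτ hB hτB, add_mul, add_sub_cancel_left,
        ← intervalIntegral.integral_mul_const]
      refine intervalIntegral.integral_congr fun x _ => ?_
      ring
    · have : Continuous (Function.uncurry fun x s => G (x - τ) (x + τ) * (G (x - s) (x + s) * g s)) := by
        unfold Function.uncurry
        fun_prop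
      exact (this.continuousOn.integrableOn_compact (isCompact_uIcc.prod isCompact_uIcc)).mono_set
        (prod_mono uIoc_subset_uIcc uIoc_subset_uIcc)
  have e3 : ∫ x in τ..B, G (x - τ) (x + τ) * ∫ s in τ..x, G (x - s) (x + s) * g s =
      ∫ s in τ..B, (G (2 * a) (τ + s) * g s - G (s - τ) (s + τ) * g s) := by
    rw [integral_triangle_swap (k := fun x s => G (x - s) (x + s)) cK hτB
      ((by fun_prop : Continuous _).intervalIntegrable _ _) (hg.intervalIntegrable _ _)]
    refine intervalIntegral.integral_congr fun s hs => ?_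
    rw [uIcc_of_le hτB] at hs
    rw [add_comm τ s, ← hG.hankel ha hτ.le hs.1 (hτ.trans_le hs.1) hB hs.2]
    ring
  have cp : Continuous fun s => G (2 * a) (τ + s) * g s := by fun_prop
  rw [e1, e2, e3, hh τ hξτ, intervalIntegral.integral_sub (cp.intervalIntegrable _ _)
    ((by fun_prop : Continuous _).intervalIntegrable _ _),
    intervalIntegral.integral_sub (cp.intervalIntegrable _ _)
    ((by fun_prop : Continuous _).intervalIntegrable _ _),
    ← intervalIntegral.integral_add_adjacent_intervals (cp.intervalIntegrable ξ τ)
    (cp.intervalIntegrable τ B)]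
  ring

/-! ### Volterra operators in `L₂(0, ∞)` -/

theorem L2Half.integrableOn_Ioc (f : L2Half) (x : ℝ) : IntegrableOn f (Ioc 0 x) := by
  have h : MemLp f 2 (volume.restrict (Ioc 0 x)) :=
    (Lp.memLp f).mono_measure (Measure.restrict_mono Ioc_subset_Ioi_self le_rfl)
  have : IsFiniteMeasure (volume.restrict (Ioc 0 x)) := ⟨by simp⟩
  exact h.integrable one_le_two

theorem L2Half.intervalIntegrable (f : L2Half) {x : ℝ} (hx : 0 ≤ x) : IntervalIntegrable f volume 0 x :=
  (intervalIntegrable_iff_integrableOn_Ioc_of_le hx).2 (f.integrableOn_Ioc x)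

theorem integral_congr_halfLine {f g : ℝ → ℝ} (h : f =ᵐ[halfLine] g) (k : ℝ → ℝ) {x : ℝ} (hx : 0 ≤ x) :
    ∫ s in (0 : ℝ)..x, k s * f s = ∫ s in (0 : ℝ)..x, k s * g s := by
  refine intervalIntegral.integral_congr_ae ?_
  have := (ae_restrict_iff' measurableSet_Ioi).1 h
  filter_upwards [this] with s hs hs'
  rw [uIoc_of_le hx] at hs'
  rw [hs hs'.1]

/-- The indicator of `(0, B]` in `L₂(0, ∞)`. -/
noncomputable def unitOn (B : ℝ) : L2Half :=
  indicatorConstLp 2 (s := Ioc 0 B) measurableSet_Ioc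
    (ne_top_of_le_ne_top (by simp) (Measure.restrict_apply_le _ _)) (1 : ℝ)

/-- Cauchy–Schwarz against the indicator. -/
theorem integral_abs_le_unitOn (f : L2Half) (B : ℝ) :
    ∫ s in Ioc 0 B, |f s| ≤ ‖unitOn B‖ * ‖f‖ := by
  have h1 : ⟪unitOn B, |f|⟫_ℝ = ∫ s in Ioc 0 B, |f s| := by
    unfold unitOn
    rw [L2.inner_indicatorConstLp_one, Measure.restrict_restrict measurableSet_Ioc,
      inter_eq_left.2 Ioc_subset_Ioi_self]
    refine integral_congr_ae ?_
    exact (Lp.coeFn_abs f).filter_mono (ae_mono (Measure.restrict_mono Ioc_subset_Ioi_self le_rfl))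
  rw [← h1, ← norm_abs_eq_norm f]
  exact (le_abs_self _).trans (abs_real_inner_le_norm _ _)

section Volterra
variable {K : ℝ → ℝ → ℝ} {B : ℝ}

/-- Only the square [0, B]² matters, where K is bounded. Keeping the indicator in the bound makes
the image square integrable. -/
theorem exists_volterra_bound (hK : Continuous fun p : ℝ × ℝ => K p.1 p.2)
    (hKB : ∀ x s, B ≤ x → 0 ≤ s → s ≤ x → K x s = 0) :
    ∃ c : ℝ, 0 ≤ c ∧ ∀ f : L2Half, ∀ x, 0 < x →
      ‖∫ s in (0 : ℝ)..x, K x s * f s‖ ≤ c * ‖f‖ * (Ioc 0 B).indicator (fun _ => 1) x := by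
  obtain ⟨C, hC⟩ := (isCompact_Icc.prod isCompact_Icc).exists_bound_of_continuousOn
    (hK.continuousOn (s := Icc 0 B ×ˢ Icc 0 B))
  refine ⟨|C| * ‖unitOn B‖, by positivity, fun f x hx => ?_⟩
  rcases le_or_gt x B with h | h
  · rw [indicator_of_mem (show x ∈ Ioc 0 B from ⟨hx, h⟩), mul_one, mul_assoc,
      intervalIntegral.integral_of_le hx.le]
    refine le_trans ?_ (mul_le_mul_of_nonneg_left (integral_abs_le_unitOn f B) (abs_nonneg C))
    rw [← integral_const_mul]
    refine (norm_integral_le_of_norm_le (g := fun s => |C| * |f s|)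
      ((f.integrableOn_Ioc x).abs.const_mul _) ?_).trans ?_
    · refine (ae_restrict_iff' measurableSet_Ioc).2 (ae_of_all _ fun s hs => ?_)
      rw [norm_mul]
      exact mul_le_mul_of_nonneg_right
        ((hC (x, s) ⟨⟨hx.le, h⟩, hs.1.le, hs.2.trans h⟩).trans (le_abs_self C)) (norm_nonneg _)
    · exact setIntegral_mono_set ((f.integrableOn_Ioc B).abs.const_mul _) (ae_of_all _ fun s => by positivity)
        (Ioc_subset_Ioc_right h).eventuallyLE
  · rw [indicator_of_notMem (fun h' => absurd h'.2 (not_le.2 h)), mul_zero, integral_eq_zero_of_forall_uIcc,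
      norm_zero]
    intro s hs
    rw [uIcc_of_le hx.le] at hs
    rw [hKB x s h.le hs.1 hs.2, zero_mul]

theorem aestronglyMeasurable_volterra (hK : Continuous fun p : ℝ × ℝ => K p.1 p.2) (f : L2Half) :
    AEStronglyMeasurable (fun x => ∫ s in (0 : ℝ)..x, K x s * f s) halfLine := by
  have hT : MeasurableSet {p : ℝ × ℝ | p.2 ≤ p.1} := measurableSet_le measurable_snd measurable_fst
  have hm : AEStronglyMeasurable (fun x => ∫ s, ({p : ℝ × ℝ | p.2 ≤ p.1}.indicator
      (fun p => K p.1 p.2 * f p.2)) (x, s) ∂halfLine) halfLine :=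
    ((hK.aestronglyMeasurable.mul (Lp.aestronglyMeasurable f).comp_snd).indicator hT).integral_prod_right'
  refine hm.congr ?_
  refine (ae_restrict_iff' measurableSet_Ioi).2 (ae_of_all _ fun x hx => ?_)
  have hx : 0 < x := hx
  simp only
  rw [intervalIntegral.integral_of_le hx.le, ← integral_indicator measurableSet_Ioi,
    ← integral_indicator measurableSet_Ioc]
  congr 1
  ext s
  simp only [indicator, mem_Ioc, mem_Ioi, mem_ofPred_eq]
  split_ifs <;> first | rfl | (exfalso; grind)

theorem exists_volterra_operator (hK : Continuous fun p : ℝ × ℝ => K p.1 p.2)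
    (hKB : ∀ x s, B ≤ x → 0 ≤ s → s ≤ x → K x s = 0) :
    ∃ V : L2Half →L[ℝ] L2Half, ∀ f : L2Half, V f =ᵐ[halfLine] fun x => ∫ s in (0 : ℝ)..x, K x s * f s := by
  obtain ⟨c, hc, hb⟩ := exists_volterra_bound hK hKB
  have hone : ∀ᵐ x ∂halfLine, ‖unitOn B x‖ = (Ioc 0 B).indicator (fun _ => 1) x := by
    have h : unitOn B =ᵐ[halfLine] (Ioc 0 B).indicator fun _ => 1 := indicatorConstLp_coeFn
    filter_upwards [h] with x hx
    rw [hx]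
    by_cases h : x ∈ Ioc 0 B <;> simp [h]
  have hae : ∀ f : L2Half, ∀ᵐ x ∂halfLine, ‖∫ s in (0 : ℝ)..x, K x s * f s‖ ≤ c * ‖f‖ * ‖unitOn B x‖ := by
    intro f
    filter_upwards [hone, ae_restrict_mem measurableSet_Ioi] with x h1 hx
    rw [h1]
    exact hb f x hx
  have hmem : ∀ f : L2Half, MemLp (fun x => ∫ s in (0 : ℝ)..x, K x s * f s) 2 halfLine := fun f =>
    (Lp.memLp (unitOn B)).of_le_mul (aestronglyMeasurable_volterra hK f) (hae f)
  have hii : ∀ f : L2Half, ∀ x, 0 < x → IntervalIntegrable (fun s => K x s * f s) volume 0 x := fun f x hx =>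
    (f.intervalIntegrable hx.le).continuousOn_mul (by fun_prop : Continuous fun s => K x s).continuousOn
  let T : L2Half →ₗ[ℝ] L2Half :=
    { toFun := fun f => (hmem f).toLp _
      map_add' := fun f g => by
        apply Lp.ext
        filter_upwards [(hmem (f + g)).coeFn_toLp, (hmem f).coeFn_toLp, (hmem g).coeFn_toLp,
          Lp.coeFn_add ((hmem f).toLp _) ((hmem g).toLp _), ae_restrict_mem measurableSet_Ioi] with x h1 h2 h3 h4 hx
        have hx : 0 < x := hx
        rw [h1, h4, Pi.add_apply, h2, h3, integral_congr_halfLine (Lp.coeFn_add f g) (K x) hx.le,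
          ← intervalIntegral.integral_add (hii f x hx) (hii g x hx)]
        refine intervalIntegral.integral_congr fun s _ => ?_
        simp only [Pi.add_apply]; ring
      map_smul' := fun r f => by
        apply Lp.ext
        filter_upwards [(hmem (r • f)).coeFn_toLp, (hmem f).coeFn_toLp,
          Lp.coeFn_smul r ((hmem f).toLp _), ae_restrict_mem measurableSet_Ioi] with x h1 h2 h4 hx
        have hx : 0 < x := hx
        rw [RingHom.id_apply, h1, h4, Pi.smul_apply, h2, integral_congr_halfLine (Lp.coeFn_smul r f) (K x) hx.le,
          smul_eq_mul, ← intervalIntegral.integral_const_mul]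
        refine intervalIntegral.integral_congr fun s _ => ?_
        simp only [Pi.smul_apply, smul_eq_mul]; ring }
  refine ⟨T.mkContinuous (c * ‖unitOn B‖) fun f => ?_, fun f => (hmem f).coeFn_toLp⟩
  have := Lp.norm_le_mul_norm_of_ae_le_mul (f := T f) (g := unitOn B) (c := c * ‖f‖) (by
    filter_upwards [(hmem f).coeFn_toLp, hae f] with x h1 h2
    change ‖(hmem f).toLp _ x‖ ≤ _
    rw [h1]
    exact h2)
  linarith

/-- `W = 1 + V`, where `V` is the Volterra operator with the kernel `K`. -/
def IsVolterraPerturbation (K : ℝ → ℝ → ℝ) (W : L2Half →L[ℝ] L2Half) : Prop :=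
  ∀ f : L2Half, W f =ᵐ[halfLine] fun x => f x + ∫ s in (0 : ℝ)..x, K x s * f s

theorem exists_isVolterraPerturbation (hK : Continuous fun p : ℝ × ℝ => K p.1 p.2)
    (hKB : ∀ x s, B ≤ x → 0 ≤ s → s ≤ x → K x s = 0) : ∃ W, IsVolterraPerturbation K W := by
  obtain ⟨V, hV⟩ := exists_volterra_operator hK hKB
  refine ⟨1 + V, fun f => ?_⟩
  filter_upwards [hV f, Lp.coeFn_add f (V f)] with x h1 h2
  change (f + V f : L2Half) x = _
  rw [h2, Pi.add_apply, h1]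

namespace IsVolterraPerturbation
variable {L : ℝ → ℝ → ℝ} {W S : L2Half →L[ℝ] L2Half}

theorem right_inverse (hW : IsVolterraPerturbation K W) (hS : IsVolterraPerturbation L S)
    (hr : IsResolvent K L) (hK : Continuous fun p : ℝ × ℝ => K p.1 p.2)
    (hL : Continuous fun p : ℝ × ℝ => L p.1 p.2) (h : L2Half) : W (S h) = h := by
  apply Lp.ext
  filter_upwards [hW (S h), hS h, ae_restrict_mem measurableSet_Ioi] with x h1 h2 hx
  have hx : 0 < x := hx
  rw [h1, h2, integral_congr_halfLine (hS h) (K x) hx.le,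
    hr.right_inverse hK hL hx.le (h.intervalIntegrable hx.le)]
  ring

/-- A null vector equals almost everywhere φ = -Vf, which is defined at every point, so the Volterra
iteration can be run pointwise on φ. -/
theorem injective (hW : IsVolterraPerturbation K W) (hK : Continuous fun p : ℝ × ℝ => K p.1 p.2)
    (hKB : ∀ x s, B ≤ x → 0 ≤ s → s ≤ x → K x s = 0) : Function.Injective W := by
  rw [injective_iff_map_eq_zero]
  intro f hf
  obtain ⟨c, hc, hb⟩ := exists_volterra_bound hK hKB
  set φ : ℝ → ℝ := fun x => -∫ s in (0 : ℝ)..x, K x s * f s with hφ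
  have hfφ : f =ᵐ[halfLine] φ := by
    have h0 := hW f
    rw [hf] at h0
    filter_upwards [h0, Lp.coeFn_zero ℝ 2 halfLine] with x h1 h2
    rw [h2, Pi.zero_apply] at h1
    simp only [hφ]
    linarith
  have hφe : ∀ x, 0 ≤ x → φ x = -∫ s in (0 : ℝ)..x, K x s * φ s := fun x hx => by
    rw [← integral_congr_halfLine hfφ (K x) hx]
  obtain ⟨C, hC⟩ := (isCompact_Icc.prod isCompact_Icc).exists_bound_of_continuousOn
    (hK.continuousOn (s := Icc 0 B ×ˢ Icc 0 B))
  have hz : ∀ x ∈ Icc 0 B, φ x = 0 := by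
    intro x hx
    refine eq_zero_of_volterra_gain (S := Icc 0 B) (ℓ := id) (u := φ) (C := c * ‖f‖) (M := |C|)
      (fun x hx => ?_) (fun n d hd x hx => ?_) hx
    · rcases hx.1.eq_or_lt with h | h
      · simp only [hφ, ← h, intervalIntegral.integral_same, neg_zero, abs_zero]
        positivity
      · have := hb f x h
        rw [indicator_of_mem (show x ∈ Ioc 0 B from ⟨h, hx.2⟩), mul_one] at this
        simp only [hφ, abs_neg]
        exact this
    · rw [hφe x hx.1, abs_neg]
      refine abs_integral_le_pow fun s hs => ?_
      rw [uIcc_of_le hx.1] at hs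
      rw [abs_mul, mul_comm d, mul_assoc]
      exact mul_le_mul ((hC (x, s) ⟨hx, hs.1, hs.2.trans hx.2⟩).trans (le_abs_self C))
        (hd s ⟨hs.1, hs.2.trans hx.2⟩) (abs_nonneg _) (abs_nonneg _)
  apply Lp.ext
  filter_upwards [hfφ, Lp.coeFn_zero ℝ 2 halfLine, ae_restrict_mem measurableSet_Ioi] with x h1 h2 hx
  have hx : 0 < x := hx
  rw [h1, h2, Pi.zero_apply]
  rcases le_or_gt x B with h | h
  · exact hz x ⟨hx.le, h⟩
  · simp only [hφ]
    rw [integral_eq_zero_of_forall_uIcc, neg_zero]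
    intro s hs
    rw [uIcc_of_le hx.le] at hs
    rw [hKB x s h.le hs.1 hs.2, zero_mul]

/-- The action of the adjoint operator. -/
theorem adjoint_apply (hW : IsVolterraPerturbation K W) (hK : Continuous fun p : ℝ × ℝ => K p.1 p.2)
    (hB : 0 ≤ B) (hKB : ∀ x s, B ≤ x → 0 ≤ s → s ≤ x → K x s = 0) {Y E : L2Half}
    (h1 : ∀ᵐ s ∂halfLine, s ≤ B → E s = Y s + ∫ x in s..B, Y x * K x s)
    (h2 : ∀ᵐ s ∂halfLine, B < s → E s = Y s) :
    ContinuousLinearMap.adjoint W Y = E := by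
  refine ext_inner_right ℝ fun g => ?_
  rw [ContinuousLinearMap.adjoint_inner_left]
  -- The identity parts of the two inner products cancel; the Volterra parts agree by exchanging the
  -- order over the triangle 0 < s < x < B.
  have hd : W g = g + (W g - g) := by abel
  have hE : E = Y + (E - Y) := by abel
  rw [hd, hE, inner_add_right, inner_add_left]
  congr 1
  rw [L2.inner_def, L2.inner_def]
  have hV : ∀ᵐ x ∂halfLine, (W g - g : L2Half) x = ∫ s in (0 : ℝ)..x, K x s * g s := by
    filter_upwards [hW g, Lp.coeFn_sub (W g) g] with x e1 e2
    rw [e2, Pi.sub_apply, e1]; ring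
  have e1 : ∫ x, ⟪Y x, (W g - g : L2Half) x⟫_ℝ ∂halfLine =
      ∫ x in (0 : ℝ)..B, Y x * ∫ s in (0 : ℝ)..x, K x s * g s := by
    rw [intervalIntegral.integral_of_le hB, ← setIntegral_eq_of_subset_of_forall_sdiff_eq_zero
      (s := Ioc 0 B) (t := Ioi 0) (f := fun x => Y x * ∫ s in (0 : ℝ)..x, K x s * g s) measurableSet_Ioi Ioc_subset_Ioi_self]
    · refine integral_congr_ae ?_
      filter_upwards [hV] with x hx
      rw [hx, Real.inner_apply]
    · intro x hx
      have hx0 : 0 < x := hx.1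
      have hxB : B ≤ x := by
        by_contra h
        exact hx.2 ⟨hx0, (not_le.1 h).le⟩
      rw [integral_eq_zero_of_forall_uIcc, mul_zero]
      intro s hs
      rw [uIcc_of_le hx0.le] at hs
      rw [hKB x s hxB hs.1 hs.2, zero_mul]
  have e2 : ∫ s, ⟪(E - Y : L2Half) s, g s⟫_ℝ ∂halfLine =
      ∫ s in (0 : ℝ)..B, (∫ x in s..B, Y x * K x s) * g s := by
    rw [intervalIntegral.integral_of_le hB, ← integral_indicator measurableSet_Ioc,
      ← integral_indicator measurableSet_Ioi]
    refine integral_congr_ae ?_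
    filter_upwards [(ae_restrict_iff' measurableSet_Ioi).1 h1, (ae_restrict_iff' measurableSet_Ioi).1 h2,
      (ae_restrict_iff' measurableSet_Ioi).1 (Lp.coeFn_sub E Y)] with s a1 a2 a3
    by_cases hs : s ∈ Ioi (0 : ℝ)
    · rw [indicator_of_mem hs, a3 hs, Pi.sub_apply, Real.inner_apply]
      rcases le_or_gt s B with h | h
      · rw [indicator_of_mem (show s ∈ Ioc 0 B from ⟨hs, h⟩), a1 hs h]; ring
      · rw [indicator_of_notMem (fun h' => absurd h'.2 (not_le.2 h)), a2 hs h]; ring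
    · rw [indicator_of_notMem hs, indicator_of_notMem (fun h' => hs h'.1)]
  rw [e1, e2, integral_triangle_swap hK hB (Y.intervalIntegrable hB) (g.intervalIntegrable hB)]

end IsVolterraPerturbation

end Volterra

/-! ### The equations on the half-line -/

theorem EqAt.const_mul {r : ℝ → ℝ} {ξ τ : ℝ} {g h : ℝ → ℝ} (H : EqAt r ξ g h τ) (c : ℝ) {h' : ℝ → ℝ}
    (hh : h' τ = c * h τ) : EqAt r ξ (fun s => c * g s) h' τ := by
  have e : (fun s => r (τ + s) * (c * g s)) = fun s => c * (r (τ + s) * g s) := by ext s; ring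
  refine ⟨?_, ?_⟩
  · rw [e]; exact H.1.const_mul c
  · rw [e, integral_const_mul, hh, ← H.2]; ring

/-- The kernel vanishes from B on, so the half-line integral lives on a compact interval and
converges. The continuous ρ stands in for r, which is controlled only on nonnegative arguments. -/
theorem eqAt_of_integral_eq {r ρ g h : ℝ → ℝ} {ξ τ B : ℝ} (hρ : Continuous ρ) (hr : ∀ η, 0 ≤ η → r η = ρ η)
    (hρB : ∀ η, B ≤ η → ρ η = 0) (hg : Continuous g) (hξ : 0 ≤ ξ) (hτ : 0 ≤ τ) (hξB : ξ ≤ B)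
    (e : g τ + ∫ s in ξ..B, ρ (τ + s) * g s = h τ) : EqAt r ξ g h τ := by
  have hz : ∀ s ∈ Ioi ξ \ Ioc ξ B, r (τ + s) * g s = 0 := by
    intro s hs
    have h1 : ξ < s := hs.1
    have h2 : B < s := by
      by_contra h
      exact hs.2 ⟨h1, not_lt.1 h⟩
    rw [hr _ (by linarith), hρB _ (by linarith), zero_mul]
  have hc : ∀ s ∈ Ioc ξ B, r (τ + s) * g s = ρ (τ + s) * g s := fun s hs => by
    rw [hr _ (by linarith [hs.1])]
  have hi : IntegrableOn (fun s => r (τ + s) * g s) (Ioc ξ B) := by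
    have : IntegrableOn (fun s => ρ (τ + s) * g s) (Ioc ξ B) :=
      (by fun_prop : Continuous fun s => ρ (τ + s) * g s).integrableOn_Ioc
    exact this.congr_fun (fun s hs => (hc s hs).symm) measurableSet_Ioc
  refine ⟨hi.of_forall_sdiff_eq_zero measurableSet_Ioi hz, ?_⟩
  rw [setIntegral_eq_of_subset_of_forall_sdiff_eq_zero measurableSet_Ioi Ioc_subset_Ioi_self hz,
    setIntegral_congr_fun measurableSet_Ioc hc, ← intervalIntegral.integral_of_le hξB, e]

theorem memLp_two_of_eq_exp {k b : ℝ} {Y : ℝ → ℝ} (hk : 0 < k) (hY : Continuous Y)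
    (hb : ∀ x, b < x → Y x = Real.exp (-k * x)) : MemLp Y 2 halfLine := by
  rw [memLp_two_iff_integrable_sq hY.aestronglyMeasurable]
  refine integrable_of_isBigO_exp_neg (b := 2 * k) (by linarith) (hY.pow 2).continuousOn ?_
  refine (Asymptotics.isBigO_refl _ _).congr' ?_ EventuallyEq.rfl
  filter_upwards [eventually_gt_atTop b] with x hx
  rw [hb x hx, ← Real.exp_nat_mul]
  congr 1
  push_cast; ring

section Target
variable {Q q : ℝ → ℝ} {a k : ℝ} {G L : ℝ → ℝ → ℝ} {y : ℝ → ℝ}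

/-- The special target extends to a continuous function on the line. -/
theorem IsSpecialTarget.exists_continuous_extension (hy : IsSpecialTarget q a k y)
    (hG : IsGoursatKernel Q a G) (ha : 0 ≤ a) (hQ : Continuous Q) (hQq : ∀ x, 0 ≤ x → Q x = q x)
    (hL : Continuous fun p : ℝ × ℝ => L p.1 p.2)
    (hr : IsResolvent (fun x s => G (x - s) (x + s)) L) :
    ∃ Y : ℝ → ℝ, Continuous Y ∧ ∀ x, 0 < x → y x = Y x := by
  have cG := hG.contDiff.continuous
  -- Applying the transposed resolvent to the exponential recovers y by a formula continuous across
  -- τ = 0. The minimum switches the integral off beyond 2a, where y is already the exponential.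
  refine ⟨fun τ => Real.exp (-k * τ) - ∫ s in (2 * a)..(min τ (2 * a)), L s τ * Real.exp (-k * s), ?_,
    fun τ hτ => ?_⟩
  · refine Continuous.sub (by fun_prop) ?_
    exact intervalIntegral.continuous_parametric_intervalIntegral_of_continuous
      (f := fun τ s => L s τ * Real.exp (-k * s)) (by fun_prop) (by fun_prop)
  · simp only
    rcases le_total τ (2 * a) with h | h
    · rw [min_eq_left h, intervalIntegral.integral_symm, sub_neg_eq_add]
      refine (hr.transpose_left_inverse (E := fun s => Real.exp (-k * s)) (by fun_prop) hL h (by fun_prop) ?_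
        fun s hs => ?_).symm
      · refine ContinuousOn.intervalIntegrable (hy.differentiableOn.continuousOn.mono fun s hs => ?_)
        rw [uIcc_of_le h] at hs
        exact hτ.trans_le hs.1
      · exact hG.transform_target ha hQ hQq hy (hτ.trans_le hs.1) le_rfl hs.2
    · rw [min_eq_right h, intervalIntegral.integral_same, sub_zero]
      exact hy.eq_exp τ (by linarith)

end Target

end Scattering

/-! ### The control problem for the special target and the Marchenko equation. -/

theorem theorem5 (q : ℝ → ℝ) (a k : ℝ) (y : ℝ → ℝ)
    (hq : ContDiffOn ℝ ∞ q (Ici 0)) (ha : 0 ≤ a) (hqa : ∀ x : ℝ, a < x → q x = 0)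
    (hk : 0 < k) (hy : IsSpecialTarget q a k y) :
    -- the objects of the system are well defined
    IsFundamentalKernel q (kernel q) ∧
    (∀ x t : ℝ, a < x → -x ≤ t → t ≤ x → kernel q x t = response q (x - t)) ∧
    IsControlOperator q (controlOperator q) ∧
    Function.Bijective (controlOperator q) ∧
    MemLp y 2 halfLine ∧
    -- the control `f = W⁻¹ y` is the solution of `C f = e^{-k·}` and satisfies the integral equation
    (∀ f : L2Half, controlOperator q f =ᵐ[halfLine] y →
      connectingOperator q f =ᵐ[halfLine] (fun τ => Real.exp (-k * τ)) ∧
      (∀ h : L2Half, connectingOperator q h =ᵐ[halfLine] (fun τ => Real.exp (-k * τ)) → h = f) ∧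
      ∀ᵐ τ ∂halfLine, EqAt (response q) 0 f (fun τ => Real.exp (-k * τ)) τ) ∧
    -- the cut-off family `F ξ τ = f^ξ(τ)` and its derivative `F' ξ τ` in `ξ`
    (∃ F F' : ℝ → ℝ → ℝ,
      ContinuousOn (fun p : ℝ × ℝ => F p.1 p.2) {p | 0 < p.1 ∧ p.1 ≤ p.2} ∧
      (∀ ξ : ℝ, 0 < ξ → ∃ f : L2Half,
        controlOperator q f =ᵐ[halfLine] (Ici ξ).indicator y ∧
        f =ᵐ[halfLine] (Ici ξ).indicator (F ξ)) ∧
      (∀ ξ : ℝ, 0 < ξ → F ξ ξ = y ξ) ∧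
      (∀ ξ τ : ℝ, 0 < ξ → ξ ≤ τ →
        EqAt (response q) ξ (F ξ) (fun τ => Real.exp (-k * τ)) τ) ∧
      (∀ ξ τ : ℝ, 0 < ξ → ξ ≤ τ →
        HasDerivWithinAt (fun η => F η τ) (F' ξ τ) (Iic τ) ξ) ∧
      (∀ ξ τ : ℝ, 0 < ξ → ξ ≤ τ →
        EqAt (response q) ξ (F' ξ) (fun τ => response q (τ + ξ) * F ξ ξ) τ) ∧
      -- the Marchenko equation for `g(ξ, τ) = f_ξ(ξ, τ) / f^ξ(ξ)`
      (∀ ξ τ : ℝ, 0 < ξ → ξ ≤ τ → F ξ ξ ≠ 0 →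
        EqAt (response q) ξ (fun s => (F ξ ξ)⁻¹ * F' ξ s)
          (fun τ => response q (τ + ξ)) τ)) := by
  obtain ⟨Q, hQ, hQq⟩ := exists_contDiff_one_extension (hq.of_le (by exact_mod_cast le_top))
  have hQc := hQ.continuous
  -- The hypothesis is silent at x = a itself; continuity from the right covers it.
  have hQa : ∀ x, a ≤ x → Q x = 0 := by
    intro x hx
    have h1 : Tendsto Q (𝓝[>] x) (𝓝 0) := by
      refine tendsto_const_nhds.congr' ?_
      filter_upwards [self_mem_nhdsWithin] with z hz
      have hz : x < z := hz
      rw [hQq z (by linarith), hqa z (by linarith)]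
    exact tendsto_nhds_unique ((hQc.tendsto x).mono_left nhdsWithin_le_nhds) h1
  obtain ⟨G, hG⟩ := exists_goursatKernel hQ ha hQa
  have cG := hG.contDiff.continuous
  set K : ℝ → ℝ → ℝ := fun x s => G (x - s) (x + s) with hKdef
  have hK : Continuous fun p : ℝ × ℝ => K p.1 p.2 := by simp only [hKdef]; fun_prop
  have hKB : ∀ x s, 2 * a ≤ x → 0 ≤ s → s ≤ x → K x s = 0 := fun x s hx hs hsx =>
    hG.eq_zero _ _ (by linarith) (by linarith)
  obtain ⟨L, hL, hr⟩ := exists_isResolvent hK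
  have hLB := hr.eq_zero hKB
  have hw := hG.isFundamentalKernel hQ hQq
  -- Existence makes the choice meaningful; its values off the wedge stay unspecified and are never
  -- used.
  have hker : IsFundamentalKernel q (kernel q) := Classical.epsilon_spec ⟨_, hw⟩
  have hkw : ∀ x t, -x ≤ t → t ≤ x → kernel q x t = G (x + t) (x - t) := fun x t h1 h2 =>
    hker.eq_on_wedge hw hQc hQq ha hQa h1 h2
  have hresp : ∀ η, 0 ≤ η → response q η = G (2 * a) η := by
    intro η hη
    refine Tendsto.limUnder_eq (tendsto_const_nhds.congr' ?_)
    filter_upwards [eventually_ge_atTop (max a η)] with s hs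
    have h1 := (le_max_left _ _).trans hs
    have h2 := (le_max_right _ _).trans hs
    rw [hkw _ _ (by linarith) (by linarith), show s - (s - η) = η by ring,
      hG.eq_const (s + (s - η)) _ (by linarith) hη (by linarith)]
  have hwave : ∀ (f : L2Half) (x : ℝ), 0 < x → wave q f x 0 = f x + ∫ s in (0 : ℝ)..x, K x s * f s := by
    intro f x hx
    simp only [wave, duhamel, add_zero]
    rw [indicator_of_mem (show x ∈ Ioi 0 from hx), intervalIntegral.integral_of_le hx.le]
    congr 1
    refine setIntegral_congr_fun measurableSet_Ioc fun s hs => ?_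
    rw [hkw _ _ (by linarith [hs.2]) (by linarith [hs.1]), zero_sub, ← sub_eq_add_neg, sub_neg_eq_add]
  have hiff : ∀ W, IsControlOperator q W ↔ IsVolterraPerturbation K W := fun W =>
    forall_congr' fun f => eventually_congr <| by
      filter_upwards [ae_restrict_mem measurableSet_Ioi] with x hx
      rw [hwave f x hx]
  obtain ⟨W₀, hW₀⟩ := exists_isVolterraPerturbation hK hKB
  have hWc : IsControlOperator q (controlOperator q) := Classical.epsilon_spec ⟨W₀, (hiff W₀).2 hW₀⟩
  set W := controlOperator q with hWdef
  have hW : IsVolterraPerturbation K W := (hiff W).1 hWc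
  obtain ⟨S, hS⟩ := exists_isVolterraPerturbation hL hLB
  have hWS : ∀ h, W (S h) = h := hW.right_inverse hS hr hK hL
  have hinj : Function.Injective W := hW.injective hK hKB
  obtain ⟨Y, hY, hyY⟩ := hy.exists_continuous_extension hG ha hQc hQq hL hr
  have hyYae : y =ᵐ[halfLine] Y := by
    filter_upwards [ae_restrict_mem measurableSet_Ioi] with x hx
    exact hyY x hx
  have hYexp : ∀ x, a < x → Y x = Real.exp (-k * x) := fun x hx => by
    rw [← hyY x (by linarith), hy.eq_exp x hx]
  have hYm : MemLp Y 2 halfLine := memLp_two_of_eq_exp hk hY hYexp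
  have hym : MemLp y 2 halfLine := hYm.ae_eq hyYae.symm
  have hEm : MemLp (fun x => Real.exp (-k * x)) 2 halfLine :=
    memLp_two_of_eq_exp (b := 0) hk (by fun_prop) fun _ _ => rfl
  have htr : ∀ τ B, 0 < τ → 2 * a ≤ B → τ ≤ B → Y τ + ∫ x in τ..B, K x τ * Y x = Real.exp (-k * τ) := by
    intro τ B h1 h2 h3
    rw [← hG.transform_target ha hQc hQq hy h1 h2 h3, hyY τ h1]
    congr 1
    refine intervalIntegral.integral_congr fun x hx => ?_
    rw [uIcc_of_le h3] at hx
    rw [hyY x (h1.trans_le hx.1)]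
  -- The inverse of W applied to the cut-off target. With Y and L continuous on the line and the
  -- plane, F makes sense for all ξ and τ, including ξ = 0.
  set F : ℝ → ℝ → ℝ := fun ξ τ => Y τ + ∫ s in ξ..τ, L τ s * Y s with hF
  have hFc : Continuous fun p : ℝ × ℝ => F p.1 p.2 := by
    have e : (fun p : ℝ × ℝ => F p.1 p.2) = fun p => Y p.2 + ((∫ s in (0 : ℝ)..p.2, L p.2 s * Y s)
        - ∫ s in (0 : ℝ)..p.1, L p.2 s * Y s) := by
      ext p
      simp only [hF]
      have c : Continuous fun s => L p.2 s * Y s := by fun_prop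
      rw [intervalIntegral.integral_interval_sub_left (c.intervalIntegrable _ _) (c.intervalIntegrable _ _)]
    rw [e]
    refine (hY.comp continuous_snd).add (Continuous.sub ?_ ?_)
    · exact intervalIntegral.continuous_parametric_intervalIntegral_of_continuous
        (f := fun (p : ℝ × ℝ) s => L p.2 s * Y s) (by fun_prop) continuous_snd
    · exact intervalIntegral.continuous_parametric_intervalIntegral_of_continuous
        (f := fun (p : ℝ × ℝ) s => L p.2 s * Y s) (by fun_prop) continuous_fst
  have hFF : ∀ ξ, F ξ ξ = Y ξ := fun ξ => by simp [hF]
  have hWF : ∀ ξ x, ξ ≤ x → Y x = F ξ x + ∫ s in ξ..x, K x s * F ξ s := by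
    intro ξ x hx
    simp only [hF]
    rw [hr.right_inverse hK hL hx (hY.intervalIntegrable _ _)]
    ring
  have hρ0 : ∀ B, 2 * a ≤ B → ∀ η, B ≤ η → G (2 * a) η = 0 := fun B hB η hη =>
    hG.eq_zero _ _ (by linarith) (hB.trans hη)
  have hρc : Continuous fun η => G (2 * a) η := by fun_prop
  have hEqF : ∀ ξ τ, 0 ≤ ξ → 0 < τ → ξ ≤ τ →
      EqAt (response q) ξ (F ξ) (fun τ => Real.exp (-k * τ)) τ := by
    intro ξ τ hξ hτ hξτ
    -- Truncating at max(2a, τ) loses nothing, since r and K vanish beyond 2a, and it leaves τ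
    -- inside the interval.
    have hB := le_max_left (2 * a) τ
    have hB' := le_max_right (2 * a) τ
    have cF : Continuous (F ξ) := by fun_prop
    refine eqAt_of_integral_eq hρc hresp (hρ0 _ hB) cF hξ hτ.le (hξτ.trans hB') ?_
    rw [hG.hankel_apply ha cF hξ hξτ hτ hB hB' (hWF ξ)]
    exact htr τ _ hτ hB hB'
  -- The Marchenko equation for -L(·, ξ): the resolvent identity is the hypothesis of `hankel_apply`
  -- with g = L(·, ξ) and h = -K(·, ξ), and `hankel` evaluates the right-hand side.
  have hEqL : ∀ ξ τ, 0 < ξ → ξ ≤ τ →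
      EqAt (response q) ξ (fun s => L s ξ) (fun τ => -response q (τ + ξ)) τ := by
    intro ξ τ hξ hξτ
    have hτ := hξ.trans_le hξτ
    have hB := le_max_left (2 * a) τ
    have hB' := le_max_right (2 * a) τ
    have cL : Continuous fun s => L s ξ := by fun_prop
    refine eqAt_of_integral_eq hρc hresp (hρ0 _ hB) cL hξ.le hτ.le (hξτ.trans hB') ?_
    rw [hG.hankel_apply ha (h := fun x => -K x ξ) cL hξ.le hξτ hτ hB hB' (fun x _ => by linarith [hr x ξ]),
      hresp _ (by linarith), ← hG.hankel ha hξ.le hξτ hτ hB hB', neg_add, ← intervalIntegral.integral_neg]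
    congr 1
    refine intervalIntegral.integral_congr fun x _ => ?_
    simp only [hKdef]
    ring
  have hSY : ∀ ξ, 0 ≤ ξ → ∃ f : L2Half, W f =ᵐ[halfLine] (Ici ξ).indicator y ∧
      f =ᵐ[halfLine] (Ici ξ).indicator (F ξ) := by
    intro ξ hξ
    have hm : MemLp ((Ici ξ).indicator y) 2 halfLine := hym.indicator measurableSet_Ici
    refine ⟨S (hm.toLp _), ?_, ?_⟩
    · rw [hWS]; exact hm.coeFn_toLp
    · filter_upwards [hS (hm.toLp _), hm.coeFn_toLp, ae_restrict_mem measurableSet_Ioi] with x h1 h2 hx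
      have hx : 0 < x := hx
      rw [h1, h2, integral_congr_halfLine hm.coeFn_toLp (L x) hx.le]
      have c : Continuous fun s => L x s * Y s := by fun_prop
      rcases lt_or_ge x ξ with h | h
      · rw [indicator_of_notMem (by simpa using h), indicator_of_notMem (by simpa using h),
          integral_eq_zero_of_forall_uIcc, add_zero]
        intro s hs
        rw [uIcc_of_le hx.le] at hs
        rw [indicator_of_notMem (by simp only [mem_Ici, not_le]; linarith [hs.2]), mul_zero]
      · rw [indicator_of_mem (mem_Ici.2 h), indicator_of_mem (mem_Ici.2 h), hyY x hx]
        simp only [hF]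
        congr 1
        rw [intervalIntegral.integral_of_le hx.le, intervalIntegral.integral_of_le h,
          ← integral_Icc_eq_integral_Ioc (x := ξ), ← integral_indicator measurableSet_Ioc,
          ← integral_indicator measurableSet_Icc]
        refine integral_congr_ae ?_
        have hne : ∀ᵐ s : ℝ, s ≠ 0 := by simp [ae_iff]
        filter_upwards [hne] with s hs
        by_cases h1 : s ∈ Icc ξ x
        · have h0 : 0 < s := lt_of_le_of_ne (hξ.trans h1.1) hs.symm
          rw [indicator_of_mem h1, indicator_of_mem (show s ∈ Ioc 0 x from ⟨h0, h1.2⟩),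
            indicator_of_mem (mem_Ici.2 h1.1), hyY s h0]
        · rw [indicator_of_notMem h1]
          by_cases h2 : s ∈ Ioc 0 x
          · rw [indicator_of_mem h2, indicator_of_notMem (show s ∉ Ici ξ from fun h3 => h1 ⟨h3, h2.2⟩), mul_zero]
          · rw [indicator_of_notMem h2]
  have hEqF' : ∀ ξ τ : ℝ, 0 < ξ → ξ ≤ τ →
      EqAt (response q) ξ (fun s => -Y ξ * L s ξ) (fun τ => response q (τ + ξ) * F ξ ξ) τ :=
    fun ξ τ hξ hξτ => (hEqL ξ τ hξ hξτ).const_mul (-Y ξ) (by simp only [hFF]; ring)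
  refine ⟨hker, fun x t hx h1 h2 => ?_, hWc, ⟨hinj, fun h => ⟨S h, hWS h⟩⟩, hym, fun f hf => ?_,
    F, fun ξ τ => -Y ξ * L τ ξ, hFc.continuousOn, fun ξ hξ => hSY ξ hξ.le,
    fun ξ hξ => by rw [hFF, hyY ξ hξ], fun ξ τ hξ hξτ => hEqF ξ τ hξ.le (hξ.trans_le hξτ) hξτ,
    fun ξ τ _ _ => ?_, hEqF', fun ξ τ hξ hξτ hne => ?_⟩
  · rw [hkw x t h1 h2, hresp _ (by linarith), hG.eq_const _ _ (by linarith) (by linarith) (by linarith)]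
  · have hWf : W f = hym.toLp y := Lp.ext (hf.trans hym.coeFn_toLp.symm)
    have hadj : ContinuousLinearMap.adjoint W (hym.toLp y) = hEm.toLp _ := by
      refine hW.adjoint_apply hK (by linarith) hKB ?_ ?_
      · filter_upwards [hym.coeFn_toLp, hEm.coeFn_toLp, ae_restrict_mem measurableSet_Ioi] with s h1 h2 hs hsB
        have hs : 0 < s := hs
        rw [h1, h2, ← htr s (2 * a) hs le_rfl hsB, hyY s hs]
        congr 1
        refine intervalIntegral.integral_congr_ae ?_
        filter_upwards [(ae_restrict_iff' measurableSet_Ioi).1 hym.coeFn_toLp] with x hx hx'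
        rw [uIoc_of_le hsB] at hx'
        have hx0 : 0 < x := hs.trans hx'.1
        rw [hx hx0, hyY x hx0, mul_comm]
      · filter_upwards [hym.coeFn_toLp, hEm.coeFn_toLp, ae_restrict_mem measurableSet_Ioi] with s h1 h2 hs hsB
        rw [h1, h2, hy.eq_exp s (by linarith)]
    have hC : connectingOperator q f = hEm.toLp _ := by
      rw [← hadj, ← hWf]; rfl
    refine ⟨by rw [hC]; exact hEm.coeFn_toLp, fun h hh => ?_, ?_⟩
    · have hCh : connectingOperator q h = connectingOperator q f := by
        rw [hC]; exact Lp.ext (hh.trans hEm.coeFn_toLp.symm)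
      -- A null vector v of C has ‖Wv‖² = ⟨Cv, v⟩ = 0, and W is injective.
      have h0 : ContinuousLinearMap.adjoint W (W (h - f)) = 0 := by
        rw [map_sub, map_sub]
        exact sub_eq_zero.2 hCh
      have h1 : ⟪W (h - f), W (h - f)⟫_ℝ = 0 := by
        rw [← ContinuousLinearMap.adjoint_inner_left, h0, inner_zero_left]
      have h2 := inner_self_eq_zero.1 h1
      exact sub_eq_zero.1 (hinj (h2.trans (map_zero W).symm))
    -- The full control is the member ξ = 0 of the cut-off family, so its integral equation is that
    -- of F 0.
    · obtain ⟨f₀, hf₀, hf₀F⟩ := hSY 0 le_rfl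
      have hff : f = f₀ := by
        refine hinj (Lp.ext ?_)
        filter_upwards [hf, hf₀, ae_restrict_mem measurableSet_Ioi] with x h1 h2 hx
        rw [h1, h2, indicator_of_mem (mem_Ici.2 (le_of_lt hx))]
      have hfF : f =ᵐ[halfLine] F 0 := by
        rw [hff]
        filter_upwards [hf₀F, ae_restrict_mem measurableSet_Ioi] with x h1 hx
        rw [h1, indicator_of_mem (mem_Ici.2 (le_of_lt hx))]
      filter_upwards [hfF, ae_restrict_mem measurableSet_Ioi] with τ h1 hτ
      obtain ⟨i, e⟩ := hEqF 0 τ le_rfl hτ (le_of_lt hτ)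
      have hcongr : (fun s => response q (τ + s) * F 0 s) =ᵐ[halfLine] fun s => response q (τ + s) * f s := by
        filter_upwards [hfF] with s hs
        rw [hs]
      exact ⟨i.congr hcongr, by rw [h1, ← integral_congr_ae hcongr, e]⟩
  -- F depends on ξ only through the lower limit, so the derivative exists from both sides, even at
  -- ξ = τ.
  · have c : Continuous fun s => L τ s * Y s := by fun_prop
    have := (intervalIntegral.integral_hasDerivAt_left (c.intervalIntegrable ξ τ)
      (c.stronglyMeasurableAtFilter _ _) c.continuousAt).const_add (Y τ)
    refine (this.congr_deriv ?_).hasDerivWithinAt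
    ring
  · refine (hEqF' ξ τ hξ hξτ).const_mul (F ξ ξ)⁻¹ ?_
    field_simp
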